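/- **Theorem 4.1.** Let $\mathcal K$ be an essentially small, rigid tensor-triangulated category: a triangulated category with a symmetric monoidal structure $\otimes$ (unit $\mathbb 1$) which is exact in each variable and for which every object has a dual. *Notation.* Let $\mathcal A=\mathrm{Mod}\text{-}\mathcal K$ be the abelian category of additive functors $\mathcal K^{\mathrm{op}}\to\mathrm{Ab}$, with the tensor product $\otimes$ given by Day convolution, and let $\hat x=\mathrm{Hom}_{\mathcal K}(-,x)\in\mathcal A$ for $x\in\mathcal K$. Let $\mathrm{mod}\text{-}\mathcal K\subset\mathcal A$ be the full subcategory of finitely presented modules, i.e. of those $M$ admitting an exact sequence $\hat y\to\hat x\to M\to 0$. The spectrum $\mathrm{Spc}(\mathcal K)$ is the set of prime ideals of $\mathcal K$, i.e. of proper thick $\otimes$-ideals $\mathcal P$ such that $x\otimes y\in\mathcal P$ implies $x\in\mathcal P$ or $y\in\mathcal P$; it carries the topology for which the supports $\mathrm{supp}(x)=\{\mathcal P\mid x\notin\mathcal P\}$, $x\in\mathcal K$, form a basis of closed subsets. A *homological prime* is a maximal proper Serre $\otimes$-ideal $\mathcal B$ of $\mathrm{mod}\text{-}\mathcal K$; it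 *lives over* $W\subseteq\mathrm{Spc}(\mathcal K)$ if the prime $\{x\in\mathcal K\mid\hat x\in\mathcal B\}$ belongs to $W$. Let $\langle\mathcal B\rangle$ be the smallest Serre subcategory of $\mathcal A$ that contains $\mathcal B$ and is closed under coproducts, and let $Q_{\mathcal B}:\mathcal A\to\mathcal A/\langle\mathcal B\rangle$ be the Gabriel quotient. A module $F\in\mathcal A$ is *$\otimes$-flat* if the functor $F\otimes-:\mathcal A\to\mathcal A$ is exact. *Statement.* Let $W\subseteq\mathrm{Spc}(\mathcal K)$ be a closed subset, let $x\in\mathcal K$, let $F\in\mathcal A$ be $\otimes$-flat, and let $f:\hat x\to F$ be a morphism in $\mathcal A$ such that $Q_{\mathcal B}(f)=0$ in $\mathcal A/\langle\mathcal B\rangle$ for every homological prime $\mathcal B$ living over $W$. Then: (a) There exist an object $s\in\mathcal K$ with $\mathrm{supp}(s)\supseteq W$ and an integer $n\ge 1$ such that $f^{\otimes n}\otimes\hat s=0$ in $\mathcal A$. (b) For every object $s$ as in (a), that is, with $\mathrm{supp}(s)\supseteq W$ and $f^{\otimes n}\otimes\hat s=0$ for some $n\ge 1$, and for every $z\in\mathcal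 K$ with $\mathrm{supp}(z)\subseteq\mathrm{supp}(s)$, there exists $m\ge 1$ with $f^{\otimes m}\otimes\hat z=0$ in $\mathcal A$. -/

import Mathlib

open CategoryTheory MonoidalCategory Limits Opposite

universe v u

noncomputable section

namespace TTNilpotence

/-! ### Tensor-triangulated categories -/

section TensorTriangulated

variable (K : Type u) [Category.{v} K] [Preadditive K] [HasZeroObject K] [HasShift K ℤ]
  [∀ n : ℤ, (shiftFunctor K n).Additive] [Pretriangulated K] [MonoidalCategory K]

/-- The tensor product of the symmetric monoidal triangulated category `K` is exact in each
variable: every functor `a ⊗ -` is additive, commutes with the suspension and preserves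
distinguished triangles. By symmetry the same then holds for the functors `- ⊗ a`. -/
class TensorTriangulated [SymmetricCategory K] : Prop extends MonoidalPreadditive K where
  tensorLeft_exact (a : K) : ∃ _ : (tensorLeft a).CommShift ℤ, (tensorLeft a).IsTriangulated

/-- A (triangular) prime of `K`: a proper thick `⊗`-ideal `P` such that `x ⊗ y ∈ P` implies
`x ∈ P` or `y ∈ P`. Thick means: a triangulated subcategory closed under direct summands. -/
structure TriangularPrime where
  /-- the objects belonging to the prime -/
  carrier : ObjectProperty K
  isTriangulated : carrier.IsTriangulated
  isStableUnderRetracts : carrier.IsStableUnderRetracts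
  tensor_mem (x : K) {y : K} (hy : carrier y) : carrier (x ⊗ y)
  exists_notMem : ∃ x : K, ¬ carrier x
  mem_or_mem {x y : K} (h : carrier (x ⊗ y)) : carrier x ∨ carrier y

/-- The support of an object, `supp x = {P | x ∉ P}`. -/
def supp {K : Type u} [Category.{v} K] [Preadditive K] [HasZeroObject K] [HasShift K ℤ]
    [∀ n : ℤ, (shiftFunctor K n).Additive] [Pretriangulated K] [MonoidalCategory K]
    (x : K) : Set (TriangularPrime K) :=
  {P | ¬ P.carrier x}

/-- The topology of the triangular spectrum: the supports of objects are a basis of closed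
subsets. -/
instance : TopologicalSpace (TriangularPrime K) :=
  TopologicalSpace.generateFrom {U | ∃ x : K, U = (supp x)ᶜ}

end TensorTriangulated

/-! ### The tensor product of abelian groups -/

namespace Ab

open scoped TensorProduct

/-- Morphisms out of `A ⊗ B` are determined by their values on pure tensors. -/
lemma hom_ext {A B : Type v} [AddCommGroup A] [AddCommGroup B] {C : AddCommGrpCat.{v}}
    {f g : AddCommGrpCat.of (A ⊗[ℤ] B) ⟶ C} (h : ∀ a b, f (a ⊗ₜ b) = g (a ⊗ₜ b)) : f = g := by
  ext t
  induction t using TensorProduct.induction_on with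
  | zero => simp
  | tmul a b => exact h a b
  | add s t hs ht => rw [map_add, map_add, hs, ht]

/-- The tensor product of homomorphisms of abelian groups. -/
def tensorHom {A A' B B' : AddCommGrpCat.{v}} (f : A ⟶ A') (g : B ⟶ B') :
    AddCommGrpCat.of (A ⊗[ℤ] B) ⟶ AddCommGrpCat.of (A' ⊗[ℤ] B') :=
  AddCommGrpCat.ofHom
    (TensorProduct.map f.hom.toIntLinearMap g.hom.toIntLinearMap).toAddMonoidHom

@[simp] lemma tensorHom_tmul {A A' B B' : AddCommGrpCat.{v}} (f : A ⟶ A') (g : B ⟶ B')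
    (a : A) (b : B) : tensorHom f g (a ⊗ₜ[ℤ] b) = f a ⊗ₜ[ℤ] g b := rfl

/-- `ℤ ⊗ A ≅ A`. -/
def leftUnitor (A : AddCommGrpCat.{v}) :
    AddCommGrpCat.of ((ULift.{v} ℤ) ⊗[ℤ] A) ≅ A :=
  (((TensorProduct.congr (ULift.moduleEquiv (R := ℤ) (M := ℤ)) (LinearEquiv.refl ℤ A)).trans
    (TensorProduct.lid ℤ A)).toAddEquiv : ((ULift.{v} ℤ) ⊗[ℤ] A) ≃+ A).toAddCommGrpIso

/-- `A ⊗ ℤ ≅ A`. -/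
def rightUnitor (A : AddCommGrpCat.{v}) :
    AddCommGrpCat.of (A ⊗[ℤ] (ULift.{v} ℤ)) ≅ A :=
  (((TensorProduct.congr (LinearEquiv.refl ℤ A) (ULift.moduleEquiv (R := ℤ) (M := ℤ))).trans
    (TensorProduct.rid ℤ A)).toAddEquiv : (A ⊗[ℤ] (ULift.{v} ℤ)) ≃+ A).toAddCommGrpIso

/-- `(A ⊗ B) ⊗ C ≅ A ⊗ (B ⊗ C)`. -/
def associator (A B C : AddCommGrpCat.{v}) :
    AddCommGrpCat.of ((A ⊗[ℤ] B) ⊗[ℤ] C) ≅ AddCommGrpCat.of (A ⊗[ℤ] (B ⊗[ℤ] C)) :=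
  ((TensorProduct.assoc ℤ A B C).toAddEquiv).toAddCommGrpIso

@[simp] lemma leftUnitor_tmul (A : AddCommGrpCat.{v}) (n : ULift.{v} ℤ) (a : A) :
    (leftUnitor A).hom (n ⊗ₜ[ℤ] a) = n.down • a := rfl

@[simp] lemma rightUnitor_tmul (A : AddCommGrpCat.{v}) (n : ULift.{v} ℤ) (a : A) :
    (rightUnitor A).hom (a ⊗ₜ[ℤ] n) = n.down • a := rfl

@[simp] lemma associator_tmul (A B C : AddCommGrpCat.{v}) (a : A) (b : B) (c : C) :
    (associator A B C).hom ((a ⊗ₜ[ℤ] b) ⊗ₜ[ℤ] c) = a ⊗ₜ[ℤ] (b ⊗ₜ[ℤ] c) := rfl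

lemma hom_ext₃ {A B C : Type v} [AddCommGroup A] [AddCommGroup B] [AddCommGroup C]
    {D : AddCommGrpCat.{v}} {f g : AddCommGrpCat.of ((A ⊗[ℤ] B) ⊗[ℤ] C) ⟶ D}
    (h : ∀ a b c, f ((a ⊗ₜ b) ⊗ₜ c) = g ((a ⊗ₜ b) ⊗ₜ c)) : f = g := by
  refine hom_ext fun t c => ?_
  induction t using TensorProduct.induction_on with
  | zero => simp
  | tmul a b => exact h a b c
  | add s t hs ht => rw [TensorProduct.add_tmul, map_add, map_add, hs, ht]

lemma hom_ext₄ {A B C D : Type v} [AddCommGroup A] [AddCommGroup B] [AddCommGroup C]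
    [AddCommGroup D] {E : AddCommGrpCat.{v}}
    {f g : AddCommGrpCat.of (((A ⊗[ℤ] B) ⊗[ℤ] C) ⊗[ℤ] D) ⟶ E}
    (h : ∀ a b c d, f (((a ⊗ₜ b) ⊗ₜ c) ⊗ₜ d) = g (((a ⊗ₜ b) ⊗ₜ c) ⊗ₜ d)) : f = g := by
  refine hom_ext₃ fun t c d => ?_
  induction t using TensorProduct.induction_on with
  | zero => simp
  | tmul a b => exact h a b c d
  | add s t hs ht => simp only [TensorProduct.add_tmul, map_add, hs, ht]

/-- The tensor product `A ⊗ B` over `ℤ` makes abelian groups into a monoidal category. -/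
instance monoidalCategory : MonoidalCategory AddCommGrpCat.{v} :=
  letI : MonoidalCategoryStruct AddCommGrpCat.{v} :=
    { tensorObj := fun A B => AddCommGrpCat.of (A ⊗[ℤ] B)
      tensorHom := fun f g => tensorHom f g
      whiskerLeft := fun A _ _ g => tensorHom (𝟙 A) g
      whiskerRight := fun f B => tensorHom f (𝟙 B)
      tensorUnit := AddCommGrpCat.of (ULift.{v} ℤ)
      associator := associator
      leftUnitor := leftUnitor
      rightUnitor := rightUnitor }
  .ofTensorHom
    (id_tensorHom_id := fun _ _ => hom_ext fun _ _ => rfl)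
    (id_tensorHom := fun _ _ _ _ => rfl)
    (tensorHom_id := fun _ _ => rfl)
    (tensorHom_comp_tensorHom := fun _ _ _ _ => hom_ext fun _ _ => rfl)
    (associator_naturality := fun _ _ _ => hom_ext₃ fun _ _ _ => rfl)
    (leftUnitor_naturality := fun f => hom_ext fun n a => (map_zsmul f.hom n.down a).symm)
    (rightUnitor_naturality := fun f => hom_ext fun a n => (map_zsmul f.hom n.down a).symm)
    (pentagon := fun _ _ _ _ => hom_ext₄ fun _ _ _ _ => rfl)
    (triangle := fun _ _ => hom_ext₃ fun a n b => (TensorProduct.smul_tmul n.down a b).symm)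

end Ab

/-! ### Right modules over `K` -/

section Modules

variable (K : Type u) [Category.{v} K] [Preadditive K]

/-- The category `Mod-K` of right `K`-modules, i.e. of additive functors from `Kᵒᵖ` to abelian
groups. -/
abbrev ModCat : Type (max u (v + 1)) := Kᵒᵖ ⥤+ AddCommGrpCat.{v}

instance : (additiveFunctor Kᵒᵖ (AddCommGrpCat.{v})).ContainsZero where
  exists_zero := by
    obtain ⟨Z, hZ⟩ := HasZeroObject.zero (C := Kᵒᵖ ⥤ AddCommGrpCat.{v})
    exact ⟨Z, hZ, Functor.Additive.of_isZero hZ⟩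

instance {J : Type} [SmallCategory J] :
    (additiveFunctor Kᵒᵖ (AddCommGrpCat.{v})).IsClosedUnderLimitsOfShape J where
  limitsOfShape_le := by
    rintro F ⟨p⟩
    constructor
    intro X Y f g
    have hY := isLimitOfPreserves ((evaluation Kᵒᵖ (AddCommGrpCat.{v})).obj Y) p.isLimit
    refine hY.hom_ext fun j => ?_
    have : (p.diag.obj j).Additive := p.prop_diag_obj j
    have h (k : X ⟶ Y) := (p.π.app j).naturality k
    dsimp at h ⊢
    rw [Preadditive.add_comp]
    erw [h (f + g), h f, h g]
    rw [Functor.map_add, Preadditive.comp_add]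

instance {J : Type} [SmallCategory J] :
    (additiveFunctor Kᵒᵖ (AddCommGrpCat.{v})).IsClosedUnderColimitsOfShape J where
  colimitsOfShape_le := by
    rintro F ⟨p⟩
    constructor
    intro X Y f g
    have hX := isColimitOfPreserves ((evaluation Kᵒᵖ (AddCommGrpCat.{v})).obj X) p.isColimit
    refine hX.hom_ext fun j => ?_
    have : (p.diag.obj j).Additive := p.prop_diag_obj j
    have h (k : X ⟶ Y) := (p.ι.app j).naturality k
    dsimp at h ⊢
    rw [Preadditive.comp_add]
    erw [← h (f + g), ← h f, ← h g]
    rw [Functor.map_add, Preadditive.add_comp]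

instance : (additiveFunctor Kᵒᵖ (AddCommGrpCat.{v})).IsClosedUnderFiniteProducts where

instance : (additiveFunctor Kᵒᵖ (AddCommGrpCat.{v})).IsClosedUnderKernels where
  kernels_le := by
    rintro _ ⟨f, k, hk, hX, hY⟩
    exact (additiveFunctor Kᵒᵖ AddCommGrpCat.{v}).prop_of_isLimit hk
      (by rintro (_ | _); exacts [hX, hY])

instance : (additiveFunctor Kᵒᵖ (AddCommGrpCat.{v})).IsClosedUnderCokernels where
  cokernels_le := by
    rintro _ ⟨f, k, hk, hX, hY⟩
    exact (additiveFunctor Kᵒᵖ AddCommGrpCat.{v}).prop_of_isColimit hk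
      (by rintro (_ | _); exacts [hX, hY])

instance : Abelian (ModCat K) :=
  inferInstanceAs (Abelian (additiveFunctor Kᵒᵖ (AddCommGrpCat.{v})).FullSubcategory)

variable {K} in
/-- The Yoneda embedding `K ⥤ Mod-K`, `x ↦ x̂ = Hom(-, x)`. -/
def yon : K ⥤ ModCat K :=
  ObjectProperty.lift _ preadditiveYoneda fun x =>
    inferInstanceAs (preadditiveYoneda.obj x).Additive

variable {K} in
/-- The module `x̂ = Hom(-, x)` represented by `x`. -/
abbrev hat (x : K) : ModCat K := yon.obj x

/-- The finitely presented `K`-modules, i.e. the objects of the Freyd envelope `mod-K`: those `M`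
that fit into an exact sequence `ŷ ⟶ x̂ ⟶ M ⟶ 0`. -/
def finPres : ObjectProperty (ModCat K) := fun M =>
  ∃ (y x : K) (g : y ⟶ x), Nonempty (M ≅ cokernel (yon.map g))

variable {K} in
/-- The localizing subcategory `⟨B⟩` of `Mod-K` generated by `B`: the smallest Serre subcategory
of `Mod-K` which contains `B` and is closed under (small) coproducts. -/
def localizingClosure (B : ObjectProperty (ModCat K)) : ObjectProperty (ModCat K) := fun M =>
  ∀ P : ObjectProperty (ModCat K), P.IsSerreClass →
    (∀ J : Type v, P.IsClosedUnderColimitsOfShape (Discrete J)) → B ≤ P → P M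

instance (B : ObjectProperty (ModCat K)) : (localizingClosure B).IsSerreClass where
  exists_zero := by
    obtain ⟨Z, hZ⟩ := HasZeroObject.zero (C := ModCat K)
    exact ⟨Z, hZ, fun P _ _ _ => P.prop_of_isZero hZ⟩
  prop_of_mono f _ hY := fun P _ hc hB => P.prop_of_mono f (hY P inferInstance hc hB)
  prop_of_epi f _ hX := fun P _ hc hB => P.prop_of_epi f (hX P inferInstance hc hB)
  prop_X₂_of_shortExact hS h₁ h₃ := fun P _ hc hB =>
    P.prop_X₂_of_shortExact hS (h₁ P inferInstance hc hB) (h₃ P inferInstance hc hB)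

variable {K} in
/-- The Gabriel quotient `Q_B : Mod-K ⥤ (Mod-K)/⟨B⟩`: the localization of the abelian category
`Mod-K` at the morphisms whose kernel and cokernel lie in `⟨B⟩`. -/
abbrev gabrielQuotient (B : ObjectProperty (ModCat K)) :
    ModCat K ⥤ (localizingClosure B).isoModSerre.Localization :=
  (localizingClosure B).isoModSerre.Q

end Modules

/-! ### Day convolution -/

section Day

variable (K : Type u) [Category.{v} K] [MonoidalCategory K] [EssentiallySmall.{v} K]

open scoped MonoidalCategory.ExternalProduct

instance : EssentiallySmall.{v} (Kᵒᵖ × Kᵒᵖ) :=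
  EssentiallySmall.mk' ((equivSmallModel.{v} Kᵒᵖ).prod (equivSmallModel.{v} Kᵒᵖ))

/-- Day convolutions of functors `Kᵒᵖ ⥤ Ab` exist for essentially small `K`; this is the left Kan
extension of `(c, d) ↦ F c ⊗ G d` along `(c, d) ↦ c ⊗ d`. -/
instance dayConvolution (F G : Kᵒᵖ ⥤ AddCommGrpCat.{v}) : DayConvolution F G :=
  have (d : Kᵒᵖ) : HasColimitsOfShape (CostructuredArrow (tensor Kᵒᵖ) d) (AddCommGrpCat.{v}) :=
    hasColimitsOfShape_of_essentiallySmall.{v} _ _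
  { convolution := (tensor Kᵒᵖ).pointwiseLeftKanExtension (F ⊠ G)
    unit := (tensor Kᵒᵖ).pointwiseLeftKanExtensionUnit (F ⊠ G)
    isPointwiseLeftKanExtensionUnit :=
      (tensor Kᵒᵖ).pointwiseLeftKanExtensionIsPointwiseLeftKanExtension (F ⊠ G) }

variable {K} [Preadditive K] [HasBinaryBiproducts K] [MonoidalPreadditive K]

open DayConvolution in
lemma unit_map_add (F G : Kᵒᵖ ⥤ AddCommGrpCat.{v}) [F.Additive] {c d : K} {X : Kᵒᵖ}
    (α β : op c ⊗ op d ⟶ X) :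
    (unit F G).app (op c, op d) ≫ (convolution F G).map (α + β) =
      (unit F G).app (op c, op d) ≫ (convolution F G).map α +
        (unit F G).app (op c, op d) ≫ (convolution F G).map β := by
  let γ : op (c ⊞ c) ⊗ op d ⟶ X :=
    Quiver.Hom.op (α.unop ≫ biprod.inl ▷ d + β.unop ≫ biprod.inr ▷ d)
  have key (p : c ⊞ c ⟶ c) : p.op ▷ op d ≫ γ =
      Quiver.Hom.op (α.unop ≫ (biprod.inl ≫ p) ▷ d + β.unop ≫ (biprod.inr ≫ p) ▷ d) := by
    apply Quiver.Hom.unop_inj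
    change (α.unop ≫ biprod.inl ▷ d + β.unop ≫ biprod.inr ▷ d) ≫ p ▷ d = _
    simp
  have h1 : biprod.fst.op ▷ op d ≫ γ = α := by
    rw [key]; apply Quiver.Hom.unop_inj; simp
  have h2 : biprod.snd.op ▷ op d ≫ γ = β := by
    rw [key]; apply Quiver.Hom.unop_inj; simp
  have h3 : (biprod.fst + biprod.snd : c ⊞ c ⟶ c).op ▷ op d ≫ γ = α + β := by
    rw [key]; apply Quiver.Hom.unop_inj; simp
  have h (p : c ⊞ c ⟶ c) : (unit F G).app (op c, op d) ≫
      (convolution F G).map (p.op ▷ op d ≫ γ) =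
      F.map p.op ▷ G.obj (op d) ≫ (unit F G).app (op (c ⊞ c), op d) ≫
        (convolution F G).map γ := by
    rw [Functor.map_comp, ← whiskerRight_comp_unit_app_assoc]
  rw [← h3, h, op_add, F.map_add, ← h1, ← h2, h, h]
  rw [← Preadditive.add_comp]
  congr 1
  exact Ab.hom_ext fun a b => TensorProduct.add_tmul _ _ _

instance (F G : Kᵒᵖ ⥤ AddCommGrpCat.{v}) [F.Additive] [G.Additive] : (DayConvolution.convolution F G).Additive where
  map_add {X Y f g} := by
    refine DayConvolution.convolution_hom_ext_at F G X fun {c d} u => ?_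
    rw [Preadditive.comp_add, Preadditive.comp_add]
    simp only [← Functor.map_comp]
    rw [Preadditive.comp_add]
    exact unit_map_add F G (c := c.unop) (d := d.unop) (u ≫ f) (u ≫ g)

/-- The tensor product of `Mod-K`, given by Day convolution. -/
def tensorObj (M N : ModCat K) : ModCat K := AdditiveFunctor.of (DayConvolution.convolution M.obj N.obj)

/-- The tensor product of morphisms in `Mod-K`. -/
def tensorMap {M M' N N' : ModCat K} (f : M ⟶ M') (g : N ⟶ N') :
    tensorObj M N ⟶ tensorObj M' N' :=
  ObjectProperty.homMk (DayConvolution.map f.hom g.hom)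

lemma tensorMap_id (M N : ModCat K) : tensorMap (𝟙 M) (𝟙 N) = 𝟙 (tensorObj M N) := by
  apply ObjectProperty.hom_ext
  change DayConvolution.map (𝟙 M.obj) (𝟙 N.obj) = 𝟙 (DayConvolution.convolution M.obj N.obj)
  refine Functor.hom_ext_of_isLeftKanExtension _ (DayConvolution.unit M.obj N.obj) _ _ ?_
  ext1; ext1 ⟨c, d⟩
  refine (DayConvolution.unit_app_map_app _ _ c d).trans ?_
  rw [NatTrans.id_app, NatTrans.id_app, id_tensorHom_id]
  exact (Category.id_comp _).trans (Category.comp_id _).symm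

lemma tensorMap_comp {M M' M'' N N' N'' : ModCat K} (f : M ⟶ M') (f' : M' ⟶ M'')
    (g : N ⟶ N') (g' : N' ⟶ N'') :
    tensorMap (f ≫ f') (g ≫ g') = tensorMap f g ≫ tensorMap f' g' := by
  apply ObjectProperty.hom_ext
  change DayConvolution.map (f.hom ≫ f'.hom) (g.hom ≫ g'.hom) =
    DayConvolution.map f.hom g.hom ≫ DayConvolution.map f'.hom g'.hom
  refine Functor.hom_ext_of_isLeftKanExtension _ (DayConvolution.unit M.obj N.obj) _ _ ?_
  ext1; ext1 ⟨c, d⟩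
  refine (DayConvolution.unit_app_map_app _ _ c d).trans ?_
  refine Eq.trans ?_ (congrArg (fun k => k ≫ (DayConvolution.map f'.hom g'.hom).app (c ⊗ d))
    (DayConvolution.unit_app_map_app f.hom g.hom c d)).symm
  rw [Category.assoc, DayConvolution.unit_app_map_app, NatTrans.comp_app, NatTrans.comp_app,
    ← tensorHom_comp_tensorHom, Category.assoc]

/-- The functor `F ⊗ - : Mod-K ⥤ Mod-K`. -/
@[simps]
def tensorFunctor (F : ModCat K) : ModCat K ⥤ ModCat K where
  obj N := tensorObj F N
  map g := tensorMap (𝟙 F) g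
  map_id N := tensorMap_id F N
  map_comp g g' := by rw [← tensorMap_comp, Category.comp_id]

/-- `F` is `⊗`-flat: the functor `F ⊗ -` is exact. -/
def IsTensorFlat (F : ModCat K) : Prop :=
  PreservesFiniteLimits (tensorFunctor F) ∧ PreservesFiniteColimits (tensorFunctor F)

/-- Tensor powers: `M^{⊗1} = M` and `M^{⊗(n+1)} = M^{⊗n} ⊗ M` for `n ≥ 1`
(and `M^{⊗0}` is the unit). -/
def tensorPow (M : ModCat K) : ℕ → ModCat K
  | 0 => hat (𝟙_ K)
  | 1 => M
  | n + 2 => tensorObj (tensorPow M (n + 1)) M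

/-- Tensor powers of a morphism: `f^{⊗1} = f` and `f^{⊗(n+1)} = f^{⊗n} ⊗ f` for `n ≥ 1`. -/
def tensorPowMap {M N : ModCat K} (f : M ⟶ N) : (n : ℕ) → (tensorPow M n ⟶ tensorPow N n)
  | 0 => 𝟙 (hat (𝟙_ K))
  | 1 => f
  | n + 2 => tensorMap (tensorPowMap f (n + 1)) f

/-- Serre `⊗`-ideals of the Freyd envelope `mod-K`. A Serre subcategory is a full subcategory that
contains zero and such that for every short exact sequence of `mod-K`, the middle term belongs to
it if and only if the two outer terms do. The sequences are taken in `Mod-K`, with finitely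
presented terms. -/
structure IsSerreTensorIdeal (B : ObjectProperty (ModCat K)) : Prop where
  le_finPres : B ≤ finPres K
  containsZero : B.ContainsZero
  mem_iff_of_shortExact (S : ShortComplex (ModCat K)) (hS : S.ShortExact)
    (h₁ : finPres K S.X₁) (h₂ : finPres K S.X₂) (h₃ : finPres K S.X₃) :
    B S.X₂ ↔ B S.X₁ ∧ B S.X₃
  tensor_mem (M : ModCat K) (hM : finPres K M) {N : ModCat K} (hN : B N) : B (tensorObj M N)

/-- Homological primes: the maximal ones among the proper Serre `⊗`-ideals of `mod-K`. -/
def IsHomologicalPrime (B : ObjectProperty (ModCat K)) : Prop :=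
  Maximal (fun C : ObjectProperty (ModCat K) => IsSerreTensorIdeal C ∧ C ≠ finPres K) B

end Day

section LivesOver

variable {K : Type u} [Category.{v} K] [Preadditive K] [HasZeroObject K] [HasShift K ℤ]
  [∀ n : ℤ, (shiftFunctor K n).Additive] [Pretriangulated K] [MonoidalCategory K]

/-- `B` lives over the subset `W` of the spectrum: the preimage `{x | x̂ ∈ B}` of `B` under the
Yoneda embedding is a prime of `K` that belongs to `W`. -/
def LivesOver (B : ObjectProperty (ModCat K)) (W : Set (TriangularPrime K)) : Prop :=
  ∃ P ∈ W, ∀ x : K, P.carrier x ↔ B (hat x)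

end LivesOver

end TTNilpotence

end

/-!
The proof tests a finitely presented module `M` against tensor powers of `f`. Let `S` be a set of
objects of `K` any two of which have a common multiple in `S`. Since `F` and the representable
modules are `⊗`-flat, the modules `M` such that `f^{⊗n} ⊗ ŝ ⊗ M = 0` for some `n ≥ 1` and `s ∈ S`
form a Serre `⊗`-ideal `J` of `mod-K` (`isSerreTensorIdeal_nilIdeal`). If no `f^{⊗n} ⊗ ŝ` vanishes,
then `J` does not contain the unit, and Zorn's lemma provides a homological prime `B ⊇ J`
(`exists_isHomologicalPrime`). Two consequences of rigidity control `B`.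

* For `s ∈ S`, the kernel `N` of the coevaluation `1̂ ⟶ (s ⊗ sᘁ)^` satisfies `ŝ ⊗ N = 0`, so it
  belongs to `J`. If `ŝ` were in `B`, then so would be `1̂`, being an extension of a submodule of
  `(s ⊗ sᘁ)^` by `N` (`exists_tensor_isZero`). Hence `B` contains no `ŝ` with `s ∈ S`.
* If `f` vanishes in the Gabriel quotient by `⟨B⟩`, then `f` is killed by some `g : y ⟶ x` for which
  the cokernel of `ĝ` belongs to `B` (`isTorsion_of_gabrielQuotient_map_eq_zero`). The kernel `N` of
  `1̂ ⟶ ᘁx^ ⊗ coker ĝ` satisfies `f ⊗ N = 0` because `F` is flat, so `N ∈ J ⊆ B` and again `1̂ ∈ B`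
  (`exists_tensorMap_eq_zero`). Hence `f` does not vanish in the quotient.

For (a), take `S = {s | W ⊆ supp s}`: as `W` is closed, the prime `{x | x̂ ∈ B}` belongs to `W`, which
contradicts the hypothesis on `f`. For (b), take `S = {z}`: the prime `{x | x̂ ∈ B}` contains `s`,
since `ŝ ∈ J`, but not `z`, which contradicts `supp z ⊆ supp s`.

Modules are handled through their elements: `M ⊗ N` is generated by pure tensors `tmul m n`, and
morphisms out of it are natural biadditive families (`tensorLift`). The tensor product of `Mod-K` is
only used up to similarity of morphisms (`Similar`), so that no coherence of associators or
braidings is needed.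
-/

noncomputable section

namespace TTNilpotence

/-! ### Elements of modules -/

section Elements

variable {K : Type u} [Category.{v} K] [Preadditive K]

/-- The abelian group `M(c)` of elements of the module `M` at the object `c`. -/
abbrev El (M : ModCat K) (c : K) : Type v := M.obj.obj (op c)

/-- Restriction of elements of a module along a morphism of `K`. -/
def res (M : ModCat K) {e c : K} (h : e ⟶ c) : El M c →+ El M e := (M.obj.map h.op).hom

/-- The action of a morphism of modules on elements. -/
def app {M N : ModCat K} (φ : M ⟶ N) (c : K) : El M c →+ El N c := (φ.hom.app (op c)).hom

@[simp] lemma res_id (M : ModCat K) (c : K) (m : El M c) : res M (𝟙 c) m = m := by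
  simp [res]

lemma res_comp (M : ModCat K) {a b c : K} (h : a ⟶ b) (k : b ⟶ c) (m : El M c) :
    res M (h ≫ k) m = res M h (res M k m) := by
  simp [res]

lemma res_add (M : ModCat K) {a b : K} (h k : a ⟶ b) (m : El M b) :
    res M (h + k) m = res M h m + res M k m := by
  have : M.obj.Additive := M.property
  simp [res, op_add, M.obj.map_add]

@[simp] lemma res_zero (M : ModCat K) {a b : K} (m : El M b) :
    res M (0 : a ⟶ b) m = 0 := by
  have := res_add M (0 : a ⟶ b) 0 m
  simpa using this

lemma res_sub (M : ModCat K) {a b : K} (h k : a ⟶ b) (m : El M b) :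
    res M (h - k) m = res M h m - res M k m := by
  rw [eq_sub_iff_add_eq, ← res_add, sub_add_cancel]

lemma app_res {M N : ModCat K} (φ : M ⟶ N) {e c : K} (h : e ⟶ c) (m : El M c) :
    app φ e (res M h m) = res N h (app φ c m) :=
  ConcreteCategory.congr_hom (φ.hom.naturality h.op) m

@[simp] lemma app_id (M : ModCat K) (c : K) (m : El M c) : app (𝟙 M) c m = m := (rfl)

@[simp] lemma app_comp {M N P : ModCat K} (φ : M ⟶ N) (ψ : N ⟶ P) (c : K) (m : El M c) :
    app (φ ≫ ψ) c m = app ψ c (app φ c m) := (rfl)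

@[simp] lemma app_zero {M N : ModCat K} (c : K) (m : El M c) :
    app (0 : M ⟶ N) c m = 0 := (rfl)

@[ext] lemma modHom_ext {M N : ModCat K} {φ ψ : M ⟶ N} (h : ∀ c m, app φ c m = app ψ c m) :
    φ = ψ := by
  apply ObjectProperty.hom_ext
  ext c m
  exact h c.unop m

/-- The morphism of modules given by a compatible family of homomorphisms. -/
def mkHom {M N : ModCat K} (φ : ∀ c, El M c →+ El N c)
    (h : ∀ {e c : K} (g : e ⟶ c) (m : El M c), φ e (res M g m) = res N g (φ c m)) : M ⟶ N :=
  ObjectProperty.homMk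
    { app c := AddCommGrpCat.ofHom (φ c.unop)
      naturality _ _ g := by
        ext m
        exact h g.unop m }

/-- A morphism `c ⟶ x`, regarded as an element of `x̂` at `c`. -/
def hatEl {c x : K} (h : c ⟶ x) : El (hat x) c := h

/-- An element of `x̂` at `c`, regarded as a morphism `c ⟶ x`. -/
def hatHom {c x : K} (m : El (hat x) c) : c ⟶ x := m

@[simp] lemma hatHom_hatEl {c x : K} (h : c ⟶ x) : hatHom (hatEl h) = h := (rfl)

@[simp] lemma hatEl_hatHom {c x : K} (m : El (hat x) c) : hatEl (hatHom m) = m := (rfl)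

@[simp] lemma hatHom_add {c x : K} (m m' : El (hat x) c) :
    hatHom (m + m') = hatHom m + hatHom m' := (rfl)

@[simp] lemma hatEl_add {c x : K} (h h' : c ⟶ x) : hatEl (h + h') = hatEl h + hatEl h' := (rfl)

@[simp] lemma hatEl_zero {c x : K} : hatEl (0 : c ⟶ x) = 0 := (rfl)

lemma hatEl_injective {c x : K} {h k : c ⟶ x} (e : hatEl h = hatEl k) : h = k := e

@[simp] lemma hatHom_res {x e c : K} (h : e ⟶ c) (m : El (hat x) c) :
    hatHom (res (hat x) h m) = h ≫ hatHom m := (rfl)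

@[simp] lemma res_hatEl {x e c : K} (h : e ⟶ c) (k : c ⟶ x) :
    res (hat x) h (hatEl k) = hatEl (h ≫ k) := (rfl)

@[simp] lemma app_yon {x y : K} (g : y ⟶ x) {c : K} (m : El (hat y) c) :
    app (yon.map g) c m = hatEl (hatHom m ≫ g) := (rfl)

/-- The morphism `x̂ ⟶ M` that corresponds to an element of `M(x)` by the Yoneda lemma. -/
def ofEl {M : ModCat K} {x : K} (m : El M x) : hat x ⟶ M :=
  mkHom (fun c => AddMonoidHom.mk' (fun h : El (hat x) c => res M (hatHom h) m)
    fun h k => res_add M (hatHom h) (hatHom k) m) fun g h => res_comp M g (hatHom h) m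

@[simp] lemma app_ofEl {M : ModCat K} {x : K} (m : El M x) {c : K} (h : El (hat x) c) :
    app (ofEl m) c h = res M (hatHom h) m := (rfl)

/-- The element of `M(x)` that corresponds to a morphism `x̂ ⟶ M` by the Yoneda lemma. -/
def toEl {M : ModCat K} {x : K} (φ : hat x ⟶ M) : El M x := app φ x (hatEl (𝟙 x))

lemma app_eq_res_toEl {M : ModCat K} {x : K} (φ : hat x ⟶ M) {c : K} (h : El (hat x) c) :
    app φ c h = res M (hatHom h) (toEl φ) := by
  rw [toEl, ← app_res, res_hatEl, Category.comp_id, hatEl_hatHom]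

@[simp] lemma toEl_ofEl {M : ModCat K} {x : K} (m : El M x) : toEl (ofEl m) = m := by
  simp [toEl]

@[simp] lemma toEl_comp {M N : ModCat K} {x : K} (φ : hat x ⟶ M) (ψ : M ⟶ N) :
    toEl (φ ≫ ψ) = app ψ x (toEl φ) := (rfl)

@[simp] lemma toEl_yon_comp {M : ModCat K} {x y : K} (g : y ⟶ x) (φ : hat x ⟶ M) :
    toEl (yon.map g ≫ φ) = res M g (toEl φ) := by
  rw [toEl_comp, app_eq_res_toEl]
  congr 2
  exact Category.id_comp g

lemma hatHom_ext {M : ModCat K} {x : K} {φ ψ : hat x ⟶ M} (h : toEl φ = toEl ψ) : φ = ψ := by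
  ext c k
  rw [app_eq_res_toEl, app_eq_res_toEl, h]

/-- Evaluation of modules at an object. -/
abbrev evalAt (c : K) : ModCat K ⥤ AddCommGrpCat.{v} :=
  (additiveFunctor Kᵒᵖ AddCommGrpCat.{v}).ι ⋙ (evaluation Kᵒᵖ AddCommGrpCat.{v}).obj (op c)

instance {J : Type} [SmallCategory J] [FinCategory J] (c : K) :
    PreservesLimitsOfShape J (evalAt c) := by
  unfold evalAt
  infer_instance

instance {J : Type} [SmallCategory J] [FinCategory J] (c : K) :
    PreservesColimitsOfShape J (evalAt c) := by
  unfold evalAt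
  infer_instance

instance (c : K) : PreservesFiniteLimits (evalAt c) := ⟨fun _ _ _ => inferInstance⟩

instance (c : K) : PreservesFiniteColimits (evalAt c) := ⟨fun _ _ _ => inferInstance⟩

lemma injective_of_mono {M N : ModCat K} (φ : M ⟶ N) [Mono φ] (c : K) :
    Function.Injective (app φ c) := by
  have : Mono ((evalAt c).map φ) := inferInstance
  exact (AddCommGrpCat.mono_iff_injective _).1 this

lemma surjective_of_epi {M N : ModCat K} (φ : M ⟶ N) [Epi φ] (c : K) :
    Function.Surjective (app φ c) := by
  have : Epi ((evalAt c).map φ) := inferInstance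
  exact (AddCommGrpCat.epi_iff_surjective _).1 this

lemma mono_of_injective {M N : ModCat K} (φ : M ⟶ N)
    (h : ∀ c, Function.Injective (app φ c)) : Mono φ where
  right_cancellation a b hab := by
    ext c m
    apply h
    rw [← app_comp, hab, app_comp]

lemma epi_of_surjective {M N : ModCat K} (φ : M ⟶ N)
    (h : ∀ c, Function.Surjective (app φ c)) : Epi φ where
  left_cancellation a b hab := by
    ext c m
    obtain ⟨m, rfl⟩ := h c m
    rw [← app_comp, hab, app_comp]

lemma el_of_exact {S : ShortComplex (ModCat K)} (hS : S.Exact) (c : K) (m : El S.X₂ c)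
    (hm : app S.g c m = 0) : ∃ m', app S.f c m' = m := by
  have := hS.map (evalAt c)
  rw [ShortComplex.ab_exact_iff] at this
  exact this m hm

lemma app_app_eq_zero (S : ShortComplex (ModCat K)) (c : K) (m : El S.X₁ c) :
    app S.g c (app S.f c m) = 0 := by
  rw [← app_comp, S.zero, app_zero]

/-- A sequence of modules is exact if it is exact on elements. -/
lemma exact_of_el {S : ShortComplex (ModCat K)}
    (h : ∀ (c : K) (m : El S.X₂ c), app S.g c m = 0 → ∃ m', app S.f c m' = m) : S.Exact := by
  rw [ShortComplex.exact_iff_epi_kernel_lift]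
  apply epi_of_surjective
  intro c m
  obtain ⟨m', hm'⟩ := h c (app (kernel.ι S.g) c m) (by
    rw [← app_comp, kernel.condition, app_zero])
  refine ⟨m', injective_of_mono (kernel.ι S.g) c ?_⟩
  rw [← app_comp, kernel.lift_ι, hm']

end Elements

/-! ### Elements of tensor products -/

section TensorElements

variable {K : Type u} [Category.{v} K] [MonoidalCategory K] [EssentiallySmall.{v} K]
  [Preadditive K] [HasBinaryBiproducts K] [MonoidalPreadditive K]

open scoped TensorProduct MonoidalCategory.ExternalProduct

/-- The pure tensor `m ⊗ n ∈ (M ⊗ N)(c ⊗ d)` of `m ∈ M(c)` and `n ∈ N(d)`. -/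
def tmul {M N : ModCat K} {c d : K} (m : El M c) (n : El N d) : El (tensorObj M N) (c ⊗ d) :=
  (DayConvolution.unit M.obj N.obj).app (op c, op d) (m ⊗ₜ[ℤ] n)

lemma tmul_add {M N : ModCat K} {c d : K} (m : El M c) (n n' : El N d) :
    tmul m (n + n') = tmul m n + tmul m n' := by
  unfold tmul
  rw [TensorProduct.tmul_add, map_add]
  rfl

lemma add_tmul {M N : ModCat K} {c d : K} (m m' : El M c) (n : El N d) :
    tmul (m + m') n = tmul m n + tmul m' n := by
  unfold tmul
  rw [TensorProduct.add_tmul, map_add]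
  rfl

@[simp] lemma zero_tmul {M N : ModCat K} {c d : K} (n : El N d) :
    tmul (0 : El M c) n = 0 := by
  simpa using add_tmul (0 : El M c) 0 n

@[simp] lemma tmul_zero {M N : ModCat K} {c d : K} (m : El M c) :
    tmul m (0 : El N d) = 0 := by
  simpa using tmul_add m (0 : El N d) 0

lemma res_tmul {M N : ModCat K} {c c' d d' : K} (h : c' ⟶ c) (k : d' ⟶ d) (m : El M c)
    (n : El N d) : res _ (h ⊗ₘ k) (tmul m n) = tmul (res M h m) (res N k n) := by
  have := ConcreteCategory.congr_hom
    (DayConvolution.unit_naturality M.obj N.obj h.op k.op) (m ⊗ₜ[ℤ] n)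
  exact this.symm

@[simp] lemma app_tensorMap {M M' N N' : ModCat K} (f : M ⟶ M') (g : N ⟶ N') {c d : K}
    (m : El M c) (n : El N d) :
    app (tensorMap f g) (c ⊗ d) (tmul m n) = tmul (app f c m) (app g d n) :=
  ConcreteCategory.congr_hom
    (DayConvolution.unit_app_map_app f.hom g.hom (op c) (op d)) (m ⊗ₜ[ℤ] n)

/-- Elements of `M ⊗ N` are sums of restrictions of pure tensors. -/
lemma tensor_induction {M N : ModCat K} {e : K} {p : El (tensorObj M N) e → Prop}
    (hz : p 0) (ha : ∀ s t, p s → p t → p (s + t)) (hn : ∀ s, p s → p (-s))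
    (hp : ∀ {c d : K} (h : e ⟶ c ⊗ d) (m : El M c) (n : El N d), p (res _ h (tmul m n)))
    (t : El (tensorObj M N) e) : p t := by
  let A : AddSubgroup (El (tensorObj M N) e) :=
    { carrier := {t | p t}, zero_mem' := hz, add_mem' := fun {s t} => ha s t,
      neg_mem' := fun {s} => hn s }
  let q : (tensorObj M N).obj.obj (op e) ⟶ AddCommGrpCat.of (El (tensorObj M N) e ⧸ A) :=
    AddCommGrpCat.ofHom (QuotientAddGroup.mk' A)
  have : q = 0 := by
    refine DayConvolution.convolution_hom_ext_at M.obj N.obj (op e) fun {c d} u => ?_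
    refine Ab.hom_ext fun m n => ?_
    change (QuotientAddGroup.mk' A) (res _ u.unop (tmul m n)) = 0
    exact (QuotientAddGroup.eq_zero_iff _).2 (hp u.unop m n)
  have ht : q t = 0 := by rw [this]; rfl
  exact (QuotientAddGroup.eq_zero_iff t).1 ht

lemma tensorHom_ext {M N P : ModCat K} {φ ψ : tensorObj M N ⟶ P}
    (h : ∀ (c d : K) (m : El M c) (n : El N d),
      app φ (c ⊗ d) (tmul m n) = app ψ (c ⊗ d) (tmul m n)) : φ = ψ := by
  ext e t
  induction t using tensor_induction with
  | hz => simp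
  | ha s t hs ht => rw [map_add, map_add, hs, ht]
  | hn s hs => rw [map_neg, map_neg, hs]
  | hp k m n => rw [app_res, app_res, h]

/-- The morphism out of `M ⊗ N` given by a natural family of biadditive maps. -/
def tensorLift {M N P : ModCat K} (β : ∀ c d : K, El M c →+ El N d →+ El P (c ⊗ d))
    (hβ : ∀ {c c' d d' : K} (h : c' ⟶ c) (k : d' ⟶ d) (m : El M c) (n : El N d),
      β c' d' (res M h m) (res N k n) = res P (h ⊗ₘ k) (β c d m n)) :
    tensorObj M N ⟶ P :=
  ObjectProperty.homMk ((DayConvolution.corepresentableBy M.obj N.obj).homEquiv.symm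
    { app := fun p => AddCommGrpCat.ofHom
        (TensorProduct.liftAddHom (β p.1.unop p.2.unop) fun r m n => by simp)
      naturality := fun p q g => Ab.hom_ext fun m n => hβ g.1.unop g.2.unop m n })

@[simp] lemma app_tensorLift {M N P : ModCat K}
    (β : ∀ c d : K, El M c →+ El N d →+ El P (c ⊗ d))
    (hβ : ∀ {c c' d d' : K} (h : c' ⟶ c) (k : d' ⟶ d) (m : El M c) (n : El N d),
      β c' d' (res M h m) (res N k n) = res P (h ⊗ₘ k) (β c d m n)) {c d : K}
    (m : El M c) (n : El N d) :
    app (tensorLift β @hβ) (c ⊗ d) (tmul m n) = β c d m n := by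
  let γ : M.obj ⊠ N.obj ⟶ tensor Kᵒᵖ ⋙ P.obj :=
    { app := fun p => AddCommGrpCat.ofHom
        (TensorProduct.liftAddHom (β p.1.unop p.2.unop) fun r m n => by simp)
      naturality := fun p q g => Ab.hom_ext fun m n => hβ g.1.unop g.2.unop m n }
  have := congrArg (fun t => t.app (op c, op d))
    ((DayConvolution.corepresentableBy M.obj N.obj).homEquiv.apply_symm_apply γ)
  exact ConcreteCategory.congr_hom this (m ⊗ₜ[ℤ] n)

end TensorElements

/-! ### Associativity and symmetry of the tensor product up to similarity -/

section Similar

variable {C : Type*} [Category* C]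

/-- Two morphisms are similar if they are isomorphic as objects of the arrow category. -/
def Similar {X Y X' Y' : C} (f : X ⟶ Y) (g : X' ⟶ Y') : Prop :=
  ∃ (e : X ≅ X') (e' : Y ≅ Y'), f ≫ e'.hom = e.hom ≫ g

lemma Similar.refl {X Y : C} (f : X ⟶ Y) : Similar f f :=
  ⟨Iso.refl _, Iso.refl _, by simp⟩

lemma Similar.symm {X Y X' Y' : C} {f : X ⟶ Y} {g : X' ⟶ Y'} (h : Similar f g) :
    Similar g f := by
  obtain ⟨e, e', h⟩ := h
  exact ⟨e.symm, e'.symm, by rw [Iso.symm_hom, Iso.symm_hom, Iso.eq_inv_comp, ← Category.assoc,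
    Iso.comp_inv_eq, h]⟩

lemma Similar.trans {X Y X' Y' X'' Y'' : C} {f : X ⟶ Y} {g : X' ⟶ Y'} {k : X'' ⟶ Y''}
    (h : Similar f g) (h' : Similar g k) : Similar f k := by
  obtain ⟨e, e', h⟩ := h
  obtain ⟨i, i', h'⟩ := h'
  exact ⟨e ≪≫ i, e' ≪≫ i', by simp [reassoc_of% h, h']⟩

lemma Similar.of_iso {X Y : C} (e : X ≅ Y) : Similar (𝟙 X) (𝟙 Y) :=
  ⟨e, e, by simp⟩

lemma Similar.eq_zero [HasZeroMorphisms C] {X Y X' Y' : C} {f : X ⟶ Y} {g : X' ⟶ Y'}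
    (h : Similar f g) (hf : f = 0) : g = 0 := by
  obtain ⟨e, e', h⟩ := h
  rw [hf, zero_comp] at h
  rw [← cancel_epi e.hom, ← h, comp_zero]

end Similar

section BiaddHom

/-- A biadditive map, as a homomorphism into a group of homomorphisms. -/
def biaddHom {A B C : Type*} [AddCommGroup A] [AddCommGroup B] [AddCommGroup C] (f : A → B → C)
    (hl : ∀ a a' b, f (a + a') b = f a b + f a' b)
    (hr : ∀ a b b', f a (b + b') = f a b + f a b') : A →+ B →+ C :=
  AddMonoidHom.mk' (fun a => AddMonoidHom.mk' (f a) (hr a)) fun a a' => by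
    ext b
    exact hl a a' b

@[simp] lemma biaddHom_apply {A B C : Type*} [AddCommGroup A] [AddCommGroup B] [AddCommGroup C]
    (f : A → B → C) (hl : ∀ a a' b, f (a + a') b = f a b + f a' b)
    (hr : ∀ a b b', f a (b + b') = f a b + f a b') (a : A) (b : B) :
    biaddHom f hl hr a b = f a b := (rfl)

end BiaddHom

section TensorIso

variable {K : Type u} [Category.{v} K] [MonoidalCategory K] [EssentiallySmall.{v} K]
  [Preadditive K] [HasBinaryBiproducts K] [MonoidalPreadditive K]

/-- The tensor product of isomorphisms of modules. -/
def tensorIso {M M' N N' : ModCat K} (e : M ≅ M') (i : N ≅ N') :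
    tensorObj M N ≅ tensorObj M' N' where
  hom := tensorMap e.hom i.hom
  inv := tensorMap e.inv i.inv
  hom_inv_id := by rw [← tensorMap_comp, e.hom_inv_id, i.hom_inv_id, tensorMap_id]
  inv_hom_id := by rw [← tensorMap_comp, e.inv_hom_id, i.inv_hom_id, tensorMap_id]

lemma Similar.tensor {M N M' N' P Q P' Q' : ModCat K} {f : M ⟶ N} {f' : M' ⟶ N'}
    {g : P ⟶ Q} {g' : P' ⟶ Q'} (h : Similar f f') (h' : Similar g g') :
    Similar (tensorMap f g) (tensorMap f' g') := by
  obtain ⟨e, e', h⟩ := h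
  obtain ⟨i, i', h'⟩ := h'
  exact ⟨tensorIso e i, tensorIso e' i', by
    dsimp only [tensorIso]; rw [← tensorMap_comp, ← tensorMap_comp, h, h']⟩

lemma tensorMap_zero {M N P Q : ModCat K} (f : M ⟶ N) : tensorMap f (0 : P ⟶ Q) = 0 :=
  tensorHom_ext fun c d m n => by simp

/-- The module `e ↦ M(e ⊗ d)`. -/
def precompRight (d : K) (M : ModCat K) : ModCat K :=
  have : M.obj.Additive := M.property
  AdditiveFunctor.of ((tensorRight d).op ⋙ M.obj)

/-- The module `e ↦ M(d ⊗ e)`. -/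
def precompLeft (d : K) (M : ModCat K) : ModCat K :=
  have : M.obj.Additive := M.property
  AdditiveFunctor.of ((tensorLeft d).op ⋙ M.obj)

lemma res_whiskerRight_tmul {M N : ModCat K} {c c' d : K} (h : c' ⟶ c) (m : El M c)
    (n : El N d) : res _ (h ▷ d) (tmul m n) = tmul (res M h m) n := by
  have := res_tmul h (𝟙 d) m n
  rwa [tensorHom_id, res_id] at this

lemma res_whiskerLeft_tmul {M N : ModCat K} {c d d' : K} (k : d' ⟶ d) (m : El M c)
    (n : El N d) : res _ (c ◁ k) (tmul m n) = tmul m (res N k n) := by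
  have := res_tmul (𝟙 c) k m n
  rwa [id_tensorHom, res_id] at this

section Associator

variable (A B C : ModCat K)

/-- The component of the associator at a fixed element of the third factor. -/
def assocHomAux {d : K} (c : El C d) :
    tensorObj A B ⟶ precompRight d (tensorObj A (tensorObj B C)) :=
  tensorLift (fun p q => biaddHom (C := El (tensorObj A (tensorObj B C)) ((p ⊗ q) ⊗ d))
      (fun a b => res _ (α_ p q d).hom (tmul a (tmul b c)))
      (fun a a' b => by rw [add_tmul, map_add])
      fun a b b' => by rw [add_tmul, tmul_add, map_add])
    fun {p p' q q'} h k a b => by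
      change res _ _ (tmul (res A h a) (tmul (res B k b) c)) =
        res _ ((h ⊗ₘ k) ▷ d) (res _ (α_ p q d).hom (tmul a (tmul b c)))
      rw [← res_whiskerRight_tmul k b c, ← res_tmul, ← res_comp, ← res_comp, ← tensorHom_id,
        ← tensorHom_id, associator_naturality]

/-- The associator on the tensor product of an element of `A ⊗ B` and an element of `C`. -/
def assocHomEl {e d : K} (c : El C d) : El (tensorObj A B) e →+
    El (tensorObj A (tensorObj B C)) (e ⊗ d) :=
  app (assocHomAux A B C c) e

lemma assocHomEl_tmul {d : K} (c : El C d) {p q : K} (a : El A p) (b : El B q) :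
    assocHomEl A B C c (tmul a b) =
      res (tensorObj A (tensorObj B C)) (α_ p q d).hom (tmul a (tmul b c)) :=
  app_tensorLift _ _ a b

lemma assocHomEl_res {d : K} (c : El C d) {e e' : K} (h : e' ⟶ e) (t : El (tensorObj A B) e) :
    assocHomEl A B C c (res _ h t) = res _ (h ▷ d) (assocHomEl A B C c t) :=
  app_res (assocHomAux A B C c) h t

/-- The associator morphism of the tensor product of modules. -/
def assocHom : tensorObj (tensorObj A B) C ⟶ tensorObj A (tensorObj B C) :=
  tensorLift (fun e d => biaddHom (fun t c => assocHomEl A B C c t)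
      (fun t t' c => map_add _ _ _)
      fun t c c' => by
        induction t using tensor_induction with
        | hz => simp
        | ha s t hs ht => simp only [map_add, hs, ht]; abel
        | hn s hs => simp only [map_neg, hs]; abel
        | hp k m n => simp only [assocHomEl_res, assocHomEl_tmul, tmul_add, map_add])
    fun {e e' d d'} h k t c => by
      simp only [biaddHom_apply]
      induction t using tensor_induction with
      | hz => simp
      | ha s t hs ht => simp only [map_add, hs, ht]
      | hn s hs => simp only [map_neg, hs]
      | hp l m n =>
        rw [assocHomEl_res, assocHomEl_res, assocHomEl_res, assocHomEl_tmul, assocHomEl_tmul,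
          ← res_whiskerLeft_tmul, ← res_whiskerLeft_tmul]
        simp only [← res_comp]
        congr 2
        simp [MonoidalCategory.tensorHom_def, whisker_exchange_assoc]

@[simp] lemma app_assocHom {p q d : K} (a : El A p) (b : El B q) (c : El C d) :
    app (assocHom A B C) _ (tmul (tmul a b) c) = res _ (α_ p q d).hom (tmul a (tmul b c)) :=
  (app_tensorLift _ _ _ _).trans (assocHomEl_tmul A B C c a b)

/-- The component of the inverse associator at a fixed element of the first factor. -/
def assocInvAux {d : K} (a : El A d) :
    tensorObj B C ⟶ precompLeft d (tensorObj (tensorObj A B) C) :=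
  tensorLift (fun p q => biaddHom (C := El (tensorObj (tensorObj A B) C) (d ⊗ (p ⊗ q)))
      (fun b c => res _ (α_ d p q).inv (tmul (tmul a b) c))
      (fun b b' c => by rw [tmul_add, add_tmul, map_add])
      fun b c c' => by rw [tmul_add, map_add])
    fun {p p' q q'} h k b c => by
      change res _ _ (tmul (tmul a (res B h b)) (res C k c)) =
        res _ (d ◁ (h ⊗ₘ k)) (res _ (α_ d p q).inv (tmul (tmul a b) c))
      rw [← res_whiskerLeft_tmul h a b, ← res_tmul, ← res_comp, ← res_comp, ← id_tensorHom,
        ← id_tensorHom, associator_inv_naturality]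

/-- The inverse associator on the tensor product of an element of `A` and an element of `B ⊗ C`. -/
def assocInvEl {d e : K} (a : El A d) : El (tensorObj B C) e →+
    El (tensorObj (tensorObj A B) C) (d ⊗ e) :=
  app (assocInvAux A B C a) e

lemma assocInvEl_tmul {d : K} (a : El A d) {p q : K} (b : El B p) (c : El C q) :
    assocInvEl A B C a (tmul b c) =
      res (tensorObj (tensorObj A B) C) (α_ d p q).inv (tmul (tmul a b) c) :=
  app_tensorLift _ _ b c

lemma assocInvEl_res {d : K} (a : El A d) {e e' : K} (h : e' ⟶ e) (t : El (tensorObj B C) e) :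
    assocInvEl A B C a (res _ h t) = res _ (d ◁ h) (assocInvEl A B C a t) :=
  app_res (assocInvAux A B C a) h t

/-- The inverse associator morphism of the tensor product of modules. -/
def assocInv : tensorObj A (tensorObj B C) ⟶ tensorObj (tensorObj A B) C :=
  tensorLift (fun d e => biaddHom (fun a t => assocInvEl A B C a t)
      (fun a a' t => by
        induction t using tensor_induction with
        | hz => simp
        | ha s t hs ht => simp only [map_add, hs, ht]; abel
        | hn s hs => simp only [map_neg, hs]; abel
        | hp k m n => simp only [assocInvEl_res, assocInvEl_tmul, add_tmul, map_add])
      fun a t t' => map_add _ _ _)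
    fun {d d' e e'} h k a t => by
      simp only [biaddHom_apply]
      induction t using tensor_induction with
      | hz => simp
      | ha s t hs ht => simp only [map_add, hs, ht]
      | hn s hs => simp only [map_neg, hs]
      | hp l m n =>
        rw [assocInvEl_res, assocInvEl_res, assocInvEl_res, assocInvEl_tmul, assocInvEl_tmul,
          ← res_whiskerRight_tmul, ← res_whiskerRight_tmul]
        simp only [← res_comp]
        congr 2
        simp [MonoidalCategory.tensorHom_def', ← whisker_exchange_assoc]

@[simp] lemma app_assocInv {p q d : K} (a : El A p) (b : El B q) (c : El C d) :
    app (assocInv A B C) _ (tmul a (tmul b c)) = res _ (α_ p q d).inv (tmul (tmul a b) c) :=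
  (app_tensorLift _ _ _ _).trans (assocInvEl_tmul A B C a b c)

variable {A B C}

lemma tensorHom_ext_left {P : ModCat K} {φ ψ : tensorObj (tensorObj A B) C ⟶ P}
    (h : ∀ (p q d : K) (a : El A p) (b : El B q) (c : El C d),
      app φ _ (tmul (tmul a b) c) = app ψ _ (tmul (tmul a b) c)) : φ = ψ := by
  refine tensorHom_ext fun e d t c => ?_
  induction t using tensor_induction with
  | hz => simp
  | ha s t hs ht => rw [add_tmul, map_add, map_add, hs, ht]
  | hn s hs =>
    have : tmul (-s) c = -tmul s c := by
      rw [eq_neg_iff_add_eq_zero, ← add_tmul, neg_add_cancel, zero_tmul]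
    rw [this, map_neg, map_neg, hs]
  | hp k m n => rw [← res_whiskerRight_tmul, app_res, app_res, h]

lemma tensorHom_ext_right {P : ModCat K} {φ ψ : tensorObj A (tensorObj B C) ⟶ P}
    (h : ∀ (p q d : K) (a : El A p) (b : El B q) (c : El C d),
      app φ _ (tmul a (tmul b c)) = app ψ _ (tmul a (tmul b c))) : φ = ψ := by
  refine tensorHom_ext fun d e a t => ?_
  induction t using tensor_induction with
  | hz => simp
  | ha s t hs ht => rw [tmul_add, map_add, map_add, hs, ht]
  | hn s hs =>
    have : tmul a (-s) = -tmul a s := by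
      rw [eq_neg_iff_add_eq_zero, ← tmul_add, neg_add_cancel, tmul_zero]
    rw [this, map_neg, map_neg, hs]
  | hp k m n => rw [← res_whiskerLeft_tmul, app_res, app_res, h]

variable (A B C)

/-- The associator of the tensor product of modules. -/
def assocIso : tensorObj (tensorObj A B) C ≅ tensorObj A (tensorObj B C) where
  hom := assocHom A B C
  inv := assocInv A B C
  hom_inv_id := tensorHom_ext_left fun p q d a b c => by
    rw [app_comp, app_assocHom, app_res, app_assocInv, ← res_comp, Iso.hom_inv_id, res_id, app_id]
  inv_hom_id := tensorHom_ext_right fun p q d a b c => by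
    rw [app_comp, app_assocInv, app_res, app_assocHom, ← res_comp, Iso.inv_hom_id, res_id, app_id]

variable {A B C}

lemma assocHom_naturality {A' B' C' : ModCat K} (f : A ⟶ A') (g : B ⟶ B') (h : C ⟶ C') :
    tensorMap (tensorMap f g) h ≫ assocHom A' B' C' =
      assocHom A B C ≫ tensorMap f (tensorMap g h) :=
  tensorHom_ext_left fun p q d a b c => by simp [app_res]

lemma similar_assoc {A' B' C' : ModCat K} (f : A ⟶ A') (g : B ⟶ B') (h : C ⟶ C') :
    Similar (tensorMap (tensorMap f g) h) (tensorMap f (tensorMap g h)) :=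
  ⟨assocIso A B C, assocIso A' B' C', assocHom_naturality f g h⟩

end Associator

section Representable

/-- The morphism `x̂ ⊗ ŷ ⟶ (x ⊗ y)^` given by the tensor product of morphisms of `K`. -/
def hatTensorHom (x y : K) : tensorObj (hat x) (hat y) ⟶ hat (x ⊗ y) :=
  tensorLift (fun c d => biaddHom (fun a b => hatEl (hatHom a ⊗ₘ hatHom b))
      (fun a a' b => by simp [MonoidalCategory.tensorHom_def])
      fun a b b' => by simp [MonoidalCategory.tensorHom_def])
    fun h k a b => by simp [tensorHom_comp_tensorHom]

lemma app_hatTensorHom {x y c d : K} (a : El (hat x) c) (b : El (hat y) d) :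
    app (hatTensorHom x y) (c ⊗ d) (tmul a b) = hatEl (hatHom a ⊗ₘ hatHom b) := by
  rw [hatTensorHom, app_tensorLift, biaddHom_apply]

/-- The tensor product of representable modules is representable. -/
def hatTensorIso (x y : K) : tensorObj (hat x) (hat y) ≅ hat (x ⊗ y) where
  hom := hatTensorHom x y
  inv := ofEl (tmul (hatEl (𝟙 x)) (hatEl (𝟙 y)))
  hom_inv_id := tensorHom_ext fun c d a b => by
    rw [app_comp, app_hatTensorHom, app_id, app_ofEl, hatHom_hatEl, res_tmul,
      res_hatEl, res_hatEl, Category.comp_id, Category.comp_id, hatEl_hatHom, hatEl_hatHom]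
  inv_hom_id := hatHom_ext (by
    rw [toEl_comp, toEl_ofEl, app_hatTensorHom, hatHom_hatEl, hatHom_hatEl, id_tensorHom_id]
    rfl)

lemma hatTensorHom_naturality {x y x' y' : K} (f : x ⟶ y) (g : x' ⟶ y') :
    tensorMap (yon.map f) (yon.map g) ≫ hatTensorHom y y' =
      hatTensorHom x x' ≫ yon.map (f ⊗ₘ g) :=
  tensorHom_ext fun c d a b => by
    rw [app_comp, app_comp, app_tensorMap, app_hatTensorHom, app_hatTensorHom]
    simp [tensorHom_comp_tensorHom]

lemma similar_tensorMap_yon {x y x' y' : K} (f : x ⟶ y) (g : x' ⟶ y') :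
    Similar (tensorMap (yon.map f) (yon.map g)) (yon.map (f ⊗ₘ g)) :=
  ⟨hatTensorIso x x', hatTensorIso y y', hatTensorHom_naturality f g⟩

end Representable

end TensorIso

section Braiding

variable {K : Type u} [Category.{v} K] [MonoidalCategory K] [EssentiallySmall.{v} K]
  [Preadditive K] [HasBinaryBiproducts K] [MonoidalPreadditive K] [SymmetricCategory K]

/-- The braiding morphism of the tensor product of modules. -/
def braidHom (M N : ModCat K) : tensorObj M N ⟶ tensorObj N M :=
  tensorLift (fun c d => biaddHom (fun m n => res _ (β_ c d).hom (tmul n m))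
      (fun m m' n => by rw [tmul_add, map_add]) fun m n n' => by rw [add_tmul, map_add])
    fun h k m n => by
      simp only [biaddHom_apply]
      rw [← res_tmul, ← res_comp, ← res_comp, BraidedCategory.braiding_naturality]

@[simp] lemma app_braidHom {M N : ModCat K} {c d : K} (m : El M c) (n : El N d) :
    app (braidHom M N) _ (tmul m n) = res _ (β_ c d).hom (tmul n m) :=
  app_tensorLift _ _ m n

lemma braidHom_braidHom (M N : ModCat K) : braidHom M N ≫ braidHom N M = 𝟙 _ :=
  tensorHom_ext fun c d m n => by
    rw [app_comp, app_braidHom, app_res, app_braidHom, ← res_comp, SymmetricCategory.symmetry,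
      res_id, app_id]

/-- The braiding of the tensor product of modules. -/
def braidIso (M N : ModCat K) : tensorObj M N ≅ tensorObj N M where
  hom := braidHom M N
  inv := braidHom N M
  hom_inv_id := braidHom_braidHom M N
  inv_hom_id := braidHom_braidHom N M

lemma braidHom_naturality {M M' N N' : ModCat K} (f : M ⟶ M') (g : N ⟶ N') :
    tensorMap f g ≫ braidHom M' N' = braidHom M N ≫ tensorMap g f :=
  tensorHom_ext fun c d m n => by simp [app_res]

lemma similar_braid {M M' N N' : ModCat K} (f : M ⟶ M') (g : N ⟶ N') :
    Similar (tensorMap f g) (tensorMap g f) :=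
  ⟨braidIso M N, braidIso M' N', braidHom_naturality f g⟩

lemma similar_left_comm {A A' B B' C C' : ModCat K} (f : A ⟶ A') (g : B ⟶ B') (h : C ⟶ C') :
    Similar (tensorMap f (tensorMap g h)) (tensorMap g (tensorMap f h)) :=
  (similar_assoc f g h).symm.trans
    (((similar_braid f g).tensor (Similar.refl h)).trans (similar_assoc g f h))

end Braiding

/-! ### Right exactness of the tensor product -/

section Exactness

variable {K : Type u} [Category.{v} K] [MonoidalCategory K] [EssentiallySmall.{v} K]
  [Preadditive K] [HasBinaryBiproducts K] [MonoidalPreadditive K]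

/-- The image of a sequence of modules under `N ⊗ -`. -/
abbrev tensorComplex (N : ModCat K) (S : ShortComplex (ModCat K)) : ShortComplex (ModCat K) :=
  ShortComplex.mk (tensorMap (𝟙 N) S.f) (tensorMap (𝟙 N) S.g) (by
    rw [← tensorMap_comp, S.zero, tensorMap_zero])

lemma tensorMap_epi {M N M' N' : ModCat K} (f : M ⟶ N) (g : M' ⟶ N') [Epi f] [Epi g] :
    Epi (tensorMap f g) := by
  apply epi_of_surjective
  intro c t
  induction t using tensor_induction with
  | hz => exact ⟨0, map_zero _⟩
  | ha s t hs ht =>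
    obtain ⟨s, rfl⟩ := hs
    obtain ⟨t, rfl⟩ := ht
    exact ⟨s + t, map_add _ _ _⟩
  | hn s hs =>
    obtain ⟨s, rfl⟩ := hs
    exact ⟨-s, map_neg _ _⟩
  | hp h m n =>
    obtain ⟨m, rfl⟩ := surjective_of_epi f _ m
    obtain ⟨n, rfl⟩ := surjective_of_epi g _ n
    exact ⟨res _ h (tmul m n), by rw [app_res, app_tensorMap]⟩

/-- The functor `N ⊗ -` is right exact: a morphism which kills the image of `N ⊗ M'` descends to
`N ⊗ M''`, as is seen on pure tensors. -/
lemma tensorComplex_exact (N : ModCat K) {S : ShortComplex (ModCat K)} (hS : S.Exact) [Epi S.g] :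
    (tensorComplex N S).Exact := by
  let q := cokernel.π (tensorMap (𝟙 N) S.f)
  have key {c d : K} (n : El N c) (m m' : El S.X₂ d) (h : app S.g d m = app S.g d m') :
      app q _ (tmul n m) = app q _ (tmul n m') := by
    obtain ⟨l, hl⟩ := el_of_exact hS d (m - m') (by rw [map_sub, h, sub_self])
    obtain rfl : m = app S.f d l + m' := by rw [hl, sub_add_cancel]
    have : tmul n (app S.f d l) = app (tensorMap (𝟙 N) S.f) _ (tmul n l) := by simp
    rw [tmul_add, map_add, this, ← app_comp, cokernel.condition, app_zero, zero_add]
  choose σ hσ using fun d => surjective_of_epi S.g d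
  let r : tensorObj N S.X₃ ⟶ cokernel (tensorMap (𝟙 N) S.f) :=
    tensorLift (fun c d => biaddHom (fun n m => app q _ (tmul n (σ d m)))
      (fun n n' m => by rw [add_tmul, map_add])
      fun n m m' => by
        rw [← map_add, ← tmul_add]
        exact key _ _ _ (by rw [map_add, hσ, hσ, hσ]))
      fun h k n m => by
        simp only [biaddHom_apply]
        rw [← app_res, res_tmul]
        exact key _ _ _ (by rw [hσ, app_res, hσ])
  have hr : tensorMap (𝟙 N) S.g ≫ r = q := tensorHom_ext fun c d n m => by
    rw [app_comp, app_tensorMap]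
    refine (app_tensorLift _ _ _ _).trans (key _ _ _ (hσ _ _))
  refine exact_of_el fun c t ht => ?_
  have hq : (ShortComplex.mk (tensorMap (𝟙 N) S.f) q (cokernel.condition _)).Exact :=
    ShortComplex.exact_cokernel _
  refine el_of_exact hq c t ?_
  change app q c t = 0
  rw [← hr, app_comp]
  exact (congrArg _ ht).trans (map_zero _)

end Exactness

/-! ### Flatness of representable modules -/

section Rigid

variable {K : Type u} [Category.{v} K] [MonoidalCategory K] [EssentiallySmall.{v} K]
  [Preadditive K] [HasBinaryBiproducts K] [MonoidalPreadditive K]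

/-- The morphism `x̂ ⊗ N ⟶ N(y ⊗ -)` for an exact pairing of `x` and `y`. -/
def hatTensorToPrecomp (x y : K) [ExactPairing x y] (N : ModCat K) :
    tensorObj (hat x) N ⟶ precompLeft y N :=
  tensorLift (fun c d => biaddHom (C := El N (y ⊗ (c ⊗ d)))
      (fun a n => res N ((tensorLeftHomEquiv (c ⊗ d) x y d).symm (hatHom a ▷ d)) n)
      (fun a a' n => by rw [← res_add]; simp [tensorLeftHomEquiv])
      fun a n n' => map_add _ _ _)
    fun {c c' d d'} h k a n => by
      change res N _ (res N k n) = res N (y ◁ (h ⊗ₘ k)) (res N _ n)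
      rw [← res_comp, ← res_comp, ← tensorLeftHomEquiv_symm_naturality]
      congr 2
      apply (tensorLeftHomEquiv _ x y _).injective
      rw [tensorLeftHomEquiv_naturality]
      simp [MonoidalCategory.tensorHom_def', whisker_exchange]

/-- The morphism `x̂ ⊗ N ⟶ N(y ⊗ -)`, on elements. -/
def hatTensorEl (x y : K) [ExactPairing x y] (N : ModCat K) (e : K) :
    El (tensorObj (hat x) N) e →+ El N (y ⊗ e) :=
  app (hatTensorToPrecomp x y N) e

lemma hatTensorEl_tmul {x y : K} [ExactPairing x y] {N : ModCat K} {c d : K} (a : El (hat x) c)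
    (n : El N d) : hatTensorEl x y N (c ⊗ d) (tmul a n) =
      res N ((tensorLeftHomEquiv (c ⊗ d) x y d).symm (hatHom a ▷ d)) n :=
  app_tensorLift _ _ a n

lemma hatTensorEl_res {x y : K} [ExactPairing x y] {N : ModCat K} {e e' : K} (h : e' ⟶ e)
    (t : El (tensorObj (hat x) N) e) :
    hatTensorEl x y N e' (res _ h t) = res N (y ◁ h) (hatTensorEl x y N e t) :=
  app_res (hatTensorToPrecomp x y N) h t

lemma hatTensorEl_app {x y : K} [ExactPairing x y] {N N' : ModCat K} (φ : N ⟶ N') {e : K}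
    (t : El (tensorObj (hat x) N) e) :
    hatTensorEl x y N' e (app (tensorMap (𝟙 _) φ) e t) =
      app φ _ (hatTensorEl x y N e t) := by
  induction t using tensor_induction with
  | hz => simp
  | ha s t hs ht => simp only [map_add, hs, ht]
  | hn s hs => simp only [map_neg, hs]
  | hp k m n =>
    rw [app_res, hatTensorEl_res, hatTensorEl_res, app_tensorMap, hatTensorEl_tmul,
      hatTensorEl_tmul, app_res, app_res, app_id]

/-- Every element of `x̂ ⊗ N` can be recovered from its image in `N(y ⊗ e)`. -/
lemma res_tmul_hatTensorEl {x y : K} [ExactPairing x y] {N : ModCat K} {e : K}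
    (t : El (tensorObj (hat x) N) e) :
    res _ (tensorLeftHomEquiv e x y (y ⊗ e) (𝟙 _))
      (tmul (hatEl (𝟙 x)) (hatTensorEl x y N e t)) = t := by
  induction t using tensor_induction with
  | hz => simp
  | ha s t hs ht => rw [map_add, tmul_add, map_add, hs, ht]
  | hn s hs =>
    have : tmul (hatEl (𝟙 x)) (-hatTensorEl x y N e s) =
        -tmul (hatEl (𝟙 x)) (hatTensorEl x y N e s) := by
      rw [eq_neg_iff_add_eq_zero, ← tmul_add, neg_add_cancel, tmul_zero]
    rw [map_neg, this, map_neg, hs]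
  | @hp c d k m n =>
    rw [hatTensorEl_res, hatTensorEl_tmul, ← res_comp, ← res_whiskerLeft_tmul, ← res_comp,
      ← tensorLeftHomEquiv_naturality, ← tensorLeftHomEquiv_symm_naturality, Category.id_comp,
      Equiv.apply_symm_apply, res_comp, res_whiskerRight_tmul, res_hatEl, Category.comp_id,
      hatEl_hatHom]

/-- Tensoring with a representable module preserves monomorphisms, since `(x̂ ⊗ N)(e)` embeds
naturally in `N(xᘁ ⊗ e)`. -/
lemma hat_tensorMap_mono (x : K) [HasRightDual x] {N N' : ModCat K} (φ : N ⟶ N') [Mono φ] :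
    Mono (tensorMap (𝟙 (hat x)) φ) := by
  apply mono_of_injective
  intro c s t hst
  have h := congrArg (hatTensorEl x xᘁ N' c) hst
  rw [hatTensorEl_app, hatTensorEl_app] at h
  rw [← res_tmul_hatTensorEl (y := xᘁ) s, ← res_tmul_hatTensorEl (y := xᘁ) t,
    injective_of_mono φ _ h]

lemma hat_tensorComplex_shortExact (x : K) [HasRightDual x] {S : ShortComplex (ModCat K)}
    (hS : S.ShortExact) : (tensorComplex (hat x) S).ShortExact :=
  have := hS.mono_f
  have := hS.epi_g
  { exact := tensorComplex_exact _ hS.exact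
    mono_f := hat_tensorMap_mono x S.f
    epi_g := tensorMap_epi _ _ }

end Rigid

/-! ### Finitely presented modules -/

section FinPres

variable {K : Type u} [Category.{v} K] [Preadditive K]

/-- The element `m ∈ M(x)` generates the module `M`, and its relations are generated by
`g : y ⟶ x`. This is the exactness of `ŷ ⟶ x̂ ⟶ M ⟶ 0`, stated on elements. -/
structure IsPresentation {M : ModCat K} {x y : K} (m : El M x) (g : y ⟶ x) : Prop where
  res_eq_zero : res M g m = 0
  exists_res (c : K) (n : El M c) : ∃ h : c ⟶ x, res M h m = n
  exists_comp {c : K} {h : c ⟶ x} (hh : res M h m = 0) : ∃ k : c ⟶ y, k ≫ g = h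

lemma IsPresentation.finPres {M : ModCat K} {x y : K} {m : El M x} {g : y ⟶ x}
    (h : IsPresentation m g) : finPres K M := by
  let S : ShortComplex (ModCat K) := ShortComplex.mk (yon.map g) (ofEl m)
    (hatHom_ext (by rw [toEl_yon_comp, toEl_ofEl, h.res_eq_zero]; rfl))
  have hS : S.Exact := exact_of_el fun c a ha => by
    obtain ⟨k, hk⟩ := h.exists_comp (h := hatHom a) (by rwa [← app_ofEl])
    exact ⟨hatEl k, by simp [S, hk]⟩
  have : Epi S.g := epi_of_surjective _ fun c n => by
    obtain ⟨k, hk⟩ := h.exists_res c n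
    exact ⟨hatEl k, by simp [S, hk]⟩
  exact ⟨y, x, g, ⟨hS.gIsCokernel.coconePointUniqueUpToIso (colimit.isColimit _)⟩⟩

lemma exists_isPresentation {M : ModCat K} (hM : finPres K M) :
    ∃ (x y : K) (m : El M x) (g : y ⟶ x), IsPresentation m g := by
  obtain ⟨y, x, g, ⟨e⟩⟩ := hM
  let π := cokernel.π (yon.map g)
  refine ⟨x, y, toEl (π ≫ e.inv), g, ?_, fun c n => ?_, fun {c h} hh => ?_⟩
  · rw [← toEl_yon_comp, cokernel.condition_assoc, zero_comp]
    rfl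
  · obtain ⟨k, hk⟩ := surjective_of_epi (π ≫ e.inv) c n
    exact ⟨hatHom k, by rw [← hk, app_eq_res_toEl]⟩
  · have hS : (ShortComplex.mk (yon.map g) π (cokernel.condition _)).Exact :=
      ShortComplex.exact_cokernel _
    rw [← hatHom_hatEl h, ← app_eq_res_toEl, app_comp] at hh
    have hh' : app π c (hatEl h) = 0 :=
      injective_of_mono e.inv c (hh.trans (map_zero _).symm)
    obtain ⟨k, hk⟩ := el_of_exact hS c _ hh'
    refine ⟨hatHom k, hatEl_injective ?_⟩
    rw [← hk]
    exact (app_yon g k).symm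

instance : (finPres K).IsClosedUnderIsomorphisms where
  of_iso := by
    rintro M N i ⟨y, x, g, ⟨e⟩⟩
    exact ⟨y, x, g, ⟨i.symm ≪≫ e⟩⟩

lemma finPres_hat (x : K) : finPres K (hat x) :=
  IsPresentation.finPres (m := hatEl (𝟙 x)) (g := (0 : x ⟶ x))
    { res_eq_zero := by simp
      exists_res := fun c n => ⟨hatHom n, by simp⟩
      exists_comp := fun {c h} hh => ⟨0, by
        rw [res_hatEl, Category.comp_id] at hh
        exact (zero_comp.trans (hatEl_injective hh).symm)⟩ }

lemma finPres_cokernel_yon {x y : K} (g : y ⟶ x) : finPres K (cokernel (yon.map g)) :=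
  ⟨y, x, g, ⟨Iso.refl _⟩⟩

/-- A cokernel of a morphism of finitely presented modules is finitely presented. -/
lemma finPres_of_exact_of_epi [HasBinaryBiproducts K] {S : ShortComplex (ModCat K)}
    (hS : S.Exact) [Epi S.g] (h₁ : finPres K S.X₁) (h₂ : finPres K S.X₂) : finPres K S.X₃ := by
  obtain ⟨x, y, m, g, hm⟩ := exists_isPresentation h₁
  obtain ⟨x', y', m', g', hm'⟩ := exists_isPresentation h₂
  obtain ⟨l, hl⟩ := hm'.exists_res x (app S.f x m)
  refine IsPresentation.finPres (m := app S.g x' m') (g := (biprod.desc l g' : x ⊞ y' ⟶ x'))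
    { res_eq_zero := ?_, exists_res := fun c n => ?_, exists_comp := fun {c h} hh => ?_ }
  · have : (biprod.desc l g' : x ⊞ y' ⟶ x') = biprod.fst ≫ l + biprod.snd ≫ g' := by
      ext <;> simp
    rw [← app_res, this, res_add, res_comp, res_comp, hl, hm'.res_eq_zero, map_zero, add_zero,
      ← app_res, app_app_eq_zero]
  · obtain ⟨n, rfl⟩ := surjective_of_epi S.g c n
    obtain ⟨h, rfl⟩ := hm'.exists_res c n
    exact ⟨h, (app_res _ _ _).symm⟩
  · rw [← app_res] at hh
    obtain ⟨n, hn⟩ := el_of_exact hS c _ hh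
    obtain ⟨k, rfl⟩ := hm.exists_res c n
    obtain ⟨r, hr⟩ := hm'.exists_comp (h := h - k ≫ l) (by
      rw [res_sub, res_comp, hl, ← app_res, hn, sub_self])
    exact ⟨biprod.lift k r, by simp [hr]⟩

end FinPres

section Triangulated

variable {K : Type u} [Category.{v} K] [Preadditive K] [HasZeroObject K] [HasShift K ℤ]
  [∀ n : ℤ, (shiftFunctor K n).Additive] [Pretriangulated K]

open Pretriangulated in
/-- Weak kernels in `K` are fibres. -/
lemma exists_weakKernel {a b : K} (h : a ⟶ b) : ∃ (w : K) (u : w ⟶ a), u ≫ h = 0 ∧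
    ∀ {e : K} (r : e ⟶ a), r ≫ h = 0 → ∃ t : e ⟶ w, t ≫ u = r := by
  obtain ⟨w, u, k, hT⟩ := distinguished_cocone_triangle₁ h
  refine ⟨w, u, comp_distTriang_mor_zero₁₂ _ hT, fun r hr => ?_⟩
  obtain ⟨t, ht⟩ := Triangle.coyoneda_exact₂ _ hT r hr
  exact ⟨t, ht.symm⟩

lemma exists_weakPullback {a b c : K} (h : a ⟶ c) (k : b ⟶ c) :
    ∃ (w : K) (p : w ⟶ a) (q : w ⟶ b), p ≫ h = q ≫ k ∧
      ∀ {e : K} (r : e ⟶ a) (s : e ⟶ b), r ≫ h = s ≫ k → ∃ t : e ⟶ w, t ≫ p = r ∧ t ≫ q = s := by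
  obtain ⟨w, u, hu, hw⟩ := exists_weakKernel (biprod.desc h (-k))
  refine ⟨w, u ≫ biprod.fst, u ≫ biprod.snd, ?_, fun r s hrs => ?_⟩
  · have : (biprod.desc h (-k)) = biprod.fst ≫ h - biprod.snd ≫ k := by ext <;> simp
    rw [this, Preadditive.comp_sub, sub_eq_zero] at hu
    simpa using hu
  · obtain ⟨t, ht⟩ := hw (biprod.lift r s) (by simp [hrs])
    exact ⟨t, by simp [reassoc_of% ht]⟩

/-- A kernel of a morphism of finitely presented modules is finitely presented, since `K` has weak
kernels. -/
lemma finPres_of_exact_of_mono {S : ShortComplex (ModCat K)}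
    (hS : S.Exact) [Mono S.f] (h₂ : finPres K S.X₂) (h₃ : finPres K S.X₃) : finPres K S.X₁ := by
  obtain ⟨x, y, m, g, hm⟩ := exists_isPresentation h₂
  obtain ⟨x', y', m', g', hm'⟩ := exists_isPresentation h₃
  obtain ⟨h, hh⟩ := hm'.exists_res x (app S.g x m)
  obtain ⟨w, u, q, huq, hw⟩ := exists_weakPullback h g'
  obtain ⟨w', u', q', huq', hw'⟩ := exists_weakPullback u g
  obtain ⟨n, hn⟩ := el_of_exact hS w (res _ u m) (by
    rw [app_res, ← hh, ← res_comp, huq, res_comp, hm'.res_eq_zero, map_zero])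
  refine IsPresentation.finPres (m := n) (g := u')
    { res_eq_zero := ?_, exists_res := fun c l => ?_, exists_comp := fun {c r} hr => ?_ }
  · apply injective_of_mono S.f
    rw [app_res, hn, ← res_comp, huq', res_comp, hm.res_eq_zero, map_zero, map_zero]
  · obtain ⟨k, hk⟩ := hm.exists_res c (app S.f c l)
    obtain ⟨s, hs⟩ := hm'.exists_comp (h := k ≫ h) (by
      rw [res_comp, hh, ← app_res, hk, app_app_eq_zero])
    obtain ⟨t, ht, -⟩ := hw k s hs.symm
    refine ⟨t, injective_of_mono S.f _ ?_⟩
    rw [app_res, hn, ← res_comp, ht, hk]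
  · obtain ⟨s, hs⟩ := hm.exists_comp (h := r ≫ u) (by
      rw [res_comp, ← hn, ← app_res, hr, map_zero])
    obtain ⟨t, ht, -⟩ := hw' r s hs.symm
    exact ⟨t, ht⟩

lemma finPres_kernel {M N : ModCat K} (φ : M ⟶ N) (hM : finPres K M) (hN : finPres K N) :
    finPres K (kernel φ) :=
  finPres_of_exact_of_mono (ShortComplex.exact_kernel φ) hM hN

lemma finPres_cokernel {M N : ModCat K} (φ : M ⟶ N) (hM : finPres K M) (hN : finPres K N) :
    finPres K (cokernel φ) :=
  have : Epi (ShortComplex.mk φ (cokernel.π φ) (cokernel.condition φ)).g :=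
    inferInstanceAs (Epi (cokernel.π φ))
  finPres_of_exact_of_epi (ShortComplex.exact_cokernel φ) hM hN

lemma finPres_image {M N : ModCat K} (φ : M ⟶ N) (hM : finPres K M) (hN : finPres K N) :
    finPres K (Abelian.image φ) :=
  finPres_kernel _ hN (finPres_cokernel φ hM hN)

variable [MonoidalCategory K] [EssentiallySmall.{v} K] [MonoidalPreadditive K]

lemma finPres_tensorObj_hat_left (x : K) {M : ModCat K} (hM : finPres K M) :
    finPres K (tensorObj (hat x) M) := by
  obtain ⟨y, z, g, ⟨e⟩⟩ := hM
  refine (finPres K).prop_of_iso (tensorIso (Iso.refl (hat x)) e.symm) ?_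
  have : Epi (tensorComplex (hat x) (ShortComplex.mk _ _ (cokernel.condition (yon.map g)))).g :=
    tensorMap_epi _ _
  have : Epi (ShortComplex.mk _ _ (cokernel.condition (yon.map g))).g :=
    inferInstanceAs (Epi (cokernel.π _))
  exact finPres_of_exact_of_epi
    (tensorComplex_exact (hat x) (ShortComplex.exact_cokernel (yon.map g)))
    ((finPres K).prop_of_iso (hatTensorIso _ _).symm (finPres_hat _))
    ((finPres K).prop_of_iso (hatTensorIso _ _).symm (finPres_hat _))

/-- Finitely presented modules are closed under tensor products, by right exactness in both
variables. -/
lemma finPres_tensorObj [SymmetricCategory K] {M N : ModCat K} (hM : finPres K M)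
    (hN : finPres K N) : finPres K (tensorObj M N) := by
  obtain ⟨y, z, g, ⟨e⟩⟩ := hN
  refine (finPres K).prop_of_iso (tensorIso (Iso.refl M) e.symm) ?_
  have : Epi (tensorComplex M (ShortComplex.mk _ _ (cokernel.condition (yon.map g)))).g :=
    tensorMap_epi _ _
  have : Epi (ShortComplex.mk _ _ (cokernel.condition (yon.map g))).g :=
    inferInstanceAs (Epi (cokernel.π _))
  exact finPres_of_exact_of_epi
    (tensorComplex_exact M (ShortComplex.exact_cokernel (yon.map g)))
    ((finPres K).prop_of_iso (braidIso _ _) (finPres_tensorObj_hat_left y hM))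
    ((finPres K).prop_of_iso (braidIso _ _) (finPres_tensorObj_hat_left z hM))

end Triangulated

/-! ### Serre ideals and homological primes -/

section SerreIdeal

variable {K : Type u} [Category.{v} K] [EssentiallySmall.{v} K]
  [Preadditive K] [HasZeroObject K] [HasShift K ℤ]
  [∀ n : ℤ, (shiftFunctor K n).Additive] [Pretriangulated K]
  [MonoidalCategory K] [MonoidalPreadditive K]

namespace IsSerreTensorIdeal

variable {B : ObjectProperty (ModCat K)} (hB : IsSerreTensorIdeal B)

include hB

lemma prop_of_epi {M N : ModCat K} (φ : M ⟶ N) [Epi φ] (hM : B M) (hN : finPres K N) : B N := by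
  let S := ShortComplex.mk _ _ (kernel.condition φ)
  have hS : S.ShortExact :=
    { exact := ShortComplex.exact_kernel φ
      mono_f := inferInstanceAs (Mono (kernel.ι φ))
      epi_g := inferInstanceAs (Epi φ) }
  exact ((hB.mem_iff_of_shortExact S hS (finPres_kernel φ (hB.le_finPres _ hM) hN)
    (hB.le_finPres _ hM) hN).1 hM).2

lemma prop_of_mono {M N : ModCat K} (φ : M ⟶ N) [Mono φ] (hN : B N) (hM : finPres K M) :
    B M := by
  let S := ShortComplex.mk _ _ (cokernel.condition φ)
  have hS : S.ShortExact :=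
    { exact := ShortComplex.exact_cokernel φ
      mono_f := inferInstanceAs (Mono φ)
      epi_g := inferInstanceAs (Epi (cokernel.π φ)) }
  exact ((hB.mem_iff_of_shortExact S hS hM (hB.le_finPres _ hN)
    (finPres_cokernel φ hM (hB.le_finPres _ hN))).1 hN).1

lemma prop_of_iso {M N : ModCat K} (e : M ≅ N) (hM : B M) : B N :=
  hB.prop_of_epi e.hom hM ((finPres K).prop_of_iso e (hB.le_finPres _ hM))

/-- The middle term of an exact sequence, not necessarily short, belongs to a Serre ideal if the
outer terms do. -/
lemma prop_of_exact {S : ShortComplex (ModCat K)} (hS : S.Exact) (h₁ : B S.X₁)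
    (h₂ : finPres K S.X₂) (h₃ : B S.X₃) : B S.X₂ := by
  have f₁ := hB.le_finPres _ h₁
  have i₁ : B (Abelian.image S.f) :=
    hB.prop_of_epi (Abelian.factorThruImage S.f) h₁ (finPres_image _ f₁ h₂)
  have := hS.mono_cokernelDesc
  have i₃ : B (cokernel S.f) :=
    hB.prop_of_mono (cokernel.desc S.f S.g S.zero) h₃ (finPres_cokernel _ f₁ h₂)
  let T := ShortComplex.mk _ _ (kernel.condition (cokernel.π S.f))
  have hT : T.ShortExact :=
    { exact := ShortComplex.exact_kernel _
      mono_f := inferInstanceAs (Mono (kernel.ι _))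
      epi_g := inferInstanceAs (Epi (cokernel.π _)) }
  exact (hB.mem_iff_of_shortExact T hT (hB.le_finPres _ i₁) h₂ (hB.le_finPres _ i₃)).2 ⟨i₁, i₃⟩

lemma prop_hat_tensor (x : K) {y : K} (hy : B (hat y)) : B (hat (x ⊗ y)) :=
  hB.prop_of_iso (hatTensorIso x y) (hB.tensor_mem _ (finPres_hat x) hy)

/-- A Serre `⊗`-ideal which contains the unit contains all finitely presented modules. -/
lemma prop_of_prop_unit (h : B (hat (𝟙_ K))) {M : ModCat K} (hM : finPres K M) : B M := by
  obtain ⟨y, x, g, ⟨e⟩⟩ := hM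
  have hx : B (hat x) := hB.prop_of_iso (yon.mapIso (ρ_ x)) (hB.prop_hat_tensor x h)
  exact hB.prop_of_iso e.symm
    (hB.prop_of_epi (cokernel.π (yon.map g)) hx (finPres_cokernel_yon g))

lemma ne_finPres_iff : B ≠ finPres K ↔ ¬ B (hat (𝟙_ K)) := by
  refine ⟨fun h h' => h ?_, fun h h' => h ?_⟩
  · ext M
    exact ⟨hB.le_finPres M, hB.prop_of_prop_unit h'⟩
  · rw [h']
    exact finPres_hat _

end IsSerreTensorIdeal

/-- Every proper Serre `⊗`-ideal is contained in a homological prime. -/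
lemma exists_isHomologicalPrime {J : ObjectProperty (ModCat K)} (hJ : IsSerreTensorIdeal J)
    (h : ¬ J (hat (𝟙_ K))) : ∃ B, J ≤ B ∧ IsHomologicalPrime B := by
  refine zorn_le_nonempty₀
    {C : ObjectProperty (ModCat K) | IsSerreTensorIdeal C ∧ C ≠ finPres K}
    (fun c hc hchain C₀ hC₀ => ?_) J ⟨hJ, hJ.ne_finPres_iff.2 h⟩
  let U : ObjectProperty (ModCat K) := fun M => ∃ C ∈ c, C M
  have hU : IsSerreTensorIdeal U :=
    { le_finPres := fun M ⟨C, hC, hM⟩ => (hc hC).1.le_finPres M hM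
      containsZero := by
        obtain ⟨Z, hZ, hZ'⟩ := (hc hC₀).1.containsZero.exists_zero
        exact ⟨Z, hZ, C₀, hC₀, hZ'⟩
      mem_iff_of_shortExact := fun S hS h₁ h₂ h₃ => by
        constructor
        · rintro ⟨C, hC, hM⟩
          have := ((hc hC).1.mem_iff_of_shortExact S hS h₁ h₂ h₃).1 hM
          exact ⟨⟨C, hC, this.1⟩, ⟨C, hC, this.2⟩⟩
        · rintro ⟨⟨C, hC, hM⟩, ⟨C', hC', hM'⟩⟩
          rcases hchain.total hC hC' with hle | hle
          · exact ⟨C', hC',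
              ((hc hC').1.mem_iff_of_shortExact S hS h₁ h₂ h₃).2 ⟨hle _ hM, hM'⟩⟩
          · exact ⟨C, hC,
              ((hc hC).1.mem_iff_of_shortExact S hS h₁ h₂ h₃).2 ⟨hM, hle _ hM'⟩⟩
      tensor_mem := fun M hM N ⟨C, hC, hN⟩ => ⟨C, hC, (hc hC).1.tensor_mem M hM hN⟩ }
  refine ⟨U, ⟨hU, hU.ne_finPres_iff.2 ?_⟩, fun C hC M hM => ⟨C, hC, hM⟩⟩
  rintro ⟨C, hC, hM⟩
  exact (hc hC).1.ne_finPres_iff.1 (hc hC).2 hM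

end SerreIdeal

section Triangles

variable {K : Type u} [Category.{v} K] [Preadditive K] [HasZeroObject K] [HasShift K ℤ]
  [∀ n : ℤ, (shiftFunctor K n).Additive] [Pretriangulated K]

open Pretriangulated in
/-- The Yoneda embedding is homological. -/
lemma yon_exact {T : Triangle K} (hT : T ∈ distTriang K) :
    (ShortComplex.mk (yon.map T.mor₁) (yon.map T.mor₂) (by
      rw [← yon.map_comp, comp_distTriang_mor_zero₁₂ _ hT]
      exact hatHom_ext (by simp [toEl]))).Exact :=
  exact_of_el fun c m hm => by
    obtain ⟨k, hk⟩ := Triangle.coyoneda_exact₂ _ hT (hatHom m)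
      (hatEl_injective (by rw [← app_yon]; exact hm))
    refine ⟨hatEl k, ?_⟩
    change app (yon.map T.mor₁) c (hatEl k) = m
    rw [app_yon, hatHom_hatEl, ← hk, hatEl_hatHom]

variable [MonoidalCategory K] [SymmetricCategory K]

/-- Tensoring with a shift of the unit is a shift. -/
lemma nonempty_shift_iso [TensorTriangulated K] (a : K) (n : ℤ) :
    Nonempty ((𝟙_ K)⟦n⟧ ⊗ a ≅ a⟦n⟧) := by
  obtain ⟨_, _⟩ := TensorTriangulated.tensorLeft_exact a
  exact ⟨β_ _ _ ≪≫ ((tensorLeft a).commShiftIso n).app (𝟙_ K) ≪≫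
    (shiftFunctor K n).mapIso (ρ_ a)⟩

end Triangles

section Prime

variable {K : Type u} [Category.{v} K] [EssentiallySmall.{v} K]
  [Preadditive K] [HasZeroObject K] [HasShift K ℤ]
  [∀ n : ℤ, (shiftFunctor K n).Additive] [Pretriangulated K]
  [MonoidalCategory K] [SymmetricCategory K]

/-- The tensor product of modules is symmetric and associative: `A ⊗ (B ⊗ C) ≅ B ⊗ (A ⊗ C)`. -/
lemma nonempty_leftComm_iso [MonoidalPreadditive K] (A B C : ModCat K) :
    Nonempty (tensorObj A (tensorObj B C) ≅ tensorObj B (tensorObj A C)) :=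
  let ⟨e, _⟩ := similar_left_comm (𝟙 A) (𝟙 B) (𝟙 C)
  ⟨e⟩

/-- The modules `M` with `x̂ ⊗ M ∈ B` form a Serre `⊗`-ideal, since `x̂ ⊗ -` is exact. -/
lemma IsSerreTensorIdeal.colon [MonoidalPreadditive K] {B : ObjectProperty (ModCat K)}
    (hB : IsSerreTensorIdeal B) (x : K) [HasRightDual x] :
    IsSerreTensorIdeal (fun M => finPres K M ∧ B (tensorObj (hat x) M)) where
  le_finPres _ h := h.1
  containsZero := by
    obtain ⟨Z, hZ, hZ'⟩ := hB.containsZero.exists_zero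
    exact ⟨Z, hZ, hB.le_finPres _ hZ', hB.tensor_mem _ (finPres_hat x) hZ'⟩
  mem_iff_of_shortExact S hS h₁ h₂ h₃ := by
    have := hB.mem_iff_of_shortExact (tensorComplex (hat x) S)
      (hat_tensorComplex_shortExact x hS) (finPres_tensorObj_hat_left x h₁)
      (finPres_tensorObj_hat_left x h₂) (finPres_tensorObj_hat_left x h₃)
    exact ⟨fun h => ⟨⟨h₁, (this.1 h.2).1⟩, ⟨h₃, (this.1 h.2).2⟩⟩,
      fun h => ⟨h₂, this.2 ⟨h.1.2, h.2.2⟩⟩⟩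
  tensor_mem M hM N hN := ⟨finPres_tensorObj hM hN.1,
    hB.prop_of_iso (nonempty_leftComm_iso _ _ _).some (hB.tensor_mem M hM hN.2)⟩

/-- Homological primes are prime with respect to representable modules: by maximality, `B` equals
the ideal of all `M` with `x̂ ⊗ M ∈ B` unless that ideal contains the unit. -/
lemma IsHomologicalPrime.prop_of_tensor_hat [MonoidalPreadditive K]
    {B : ObjectProperty (ModCat K)}
    (hB : IsHomologicalPrime B) {x : K} [HasRightDual x] (hx : ¬ B (hat x)) {M : ModCat K}
    (hM : finPres K M) (h : B (tensorObj (hat x) M)) : B M := by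
  have hC := hB.prop.1.colon x
  refine hB.le_of_ge (y := fun M => finPres K M ∧ B (tensorObj (hat x) M))
    ⟨hC, hC.ne_finPres_iff.2 fun hu => hx ?_⟩ (fun N hN =>
      ⟨hB.prop.1.le_finPres _ hN, hB.prop.1.tensor_mem _ (finPres_hat x) hN⟩) M ⟨hM, h⟩
  exact hB.prop.1.prop_of_iso (hatTensorIso _ _ ≪≫ yon.mapIso (ρ_ x)) hu.2

open ZeroObject in
/-- The prime `{x | x̂ ∈ B}` of `K` over which the homological prime `B` lives. -/
def IsHomologicalPrime.prime [TensorTriangulated K] [RightRigidCategory K]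
    {B : ObjectProperty (ModCat K)} (hB : IsHomologicalPrime B) : TriangularPrime K where
  carrier x := B (hat x)
  isTriangulated :=
    { exists_zero := by
        refine ⟨0, isZero_zero K, ?_⟩
        obtain ⟨Z, hZ, hZ'⟩ := hB.prop.1.containsZero.exists_zero
        have : IsZero (hat (0 : K)) := by
          rw [IsZero.iff_id_eq_zero, ← yon.map_id, (isZero_zero K).eq_of_src (𝟙 0) 0]
          exact hatHom_ext (by simp [toEl])
        exact hB.prop.1.prop_of_iso (hZ.iso this) hZ'
      isStableUnderShiftBy n :=
        { le_shift := fun x hx => hB.prop.1.prop_of_iso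
            (yon.mapIso (nonempty_shift_iso x n).some) (hB.prop.1.prop_hat_tensor _ hx) }
      ext₂' := fun T hT h₁ h₃ => ObjectProperty.le_isoClosure _ _
        (hB.prop.1.prop_of_exact (yon_exact hT) h₁ (finPres_hat _) h₃) }
  isStableUnderRetracts :=
    { of_retract := fun {x y} r hy => by
        have : Mono (yon.map r.i) := ⟨fun a b h => by
          have := congrArg (· ≫ yon.map r.r) h
          simpa [← yon.map_comp] using this⟩
        exact hB.prop.1.prop_of_mono (yon.map r.i) hy (finPres_hat _) }
  tensor_mem x y hy := hB.prop.1.prop_hat_tensor x hy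
  exists_notMem := ⟨𝟙_ K, hB.prop.1.ne_finPres_iff.1 hB.prop.2⟩
  mem_or_mem {x y} h := by
    by_contra! hn
    exact hn.2 (hB.prop_of_tensor_hat hn.1 (finPres_hat y)
      (hB.prop.1.prop_of_iso (hatTensorIso x y).symm h))

end Prime

/-! ### Torsion elements and the Gabriel quotient -/

section Torsion

instance {K : Type u} [Category.{v} K] [Preadditive K] (J : Type v) :
    (additiveFunctor Kᵒᵖ AddCommGrpCat.{v}).IsClosedUnderColimitsOfShape (Discrete J) where
  colimitsOfShape_le := by
    rintro F ⟨p⟩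
    constructor
    intro X Y f g
    have hX := isColimitOfPreserves ((evaluation Kᵒᵖ AddCommGrpCat.{v}).obj X) p.isColimit
    refine hX.hom_ext fun j => ?_
    have : (p.diag.obj j).Additive := p.prop_diag_obj j
    have h (k : X ⟶ Y) := (p.ι.app j).naturality k
    dsimp at h ⊢
    rw [Preadditive.comp_add]
    erw [← h (f + g), ← h f, ← h g]
    rw [Functor.map_add, Preadditive.add_comp]

variable {K : Type u} [Category.{v} K] [EssentiallySmall.{v} K]
  [Preadditive K] [HasZeroObject K] [HasShift K ℤ]
  [∀ n : ℤ, (shiftFunctor K n).Additive] [Pretriangulated K]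
  [MonoidalCategory K] [MonoidalPreadditive K]

/-- An element of a module is `B`-torsion if it is killed by a morphism `g` of `K` such that the
cokernel of `ĝ` belongs to `B`. -/
def IsTorsion (B : ObjectProperty (ModCat K)) {M : ModCat K} {x : K} (m : El M x) : Prop :=
  ∃ (y : K) (g : y ⟶ x), res M g m = 0 ∧ B (cokernel (yon.map g))

namespace IsSerreTensorIdeal

variable {B : ObjectProperty (ModCat K)} (hB : IsSerreTensorIdeal B)

include hB

/-- The cokernel of a composition is an extension of the cokernel of the last morphism by a quotient
of the cokernel of the first one. -/
lemma prop_cokernel_comp {x y z : K} (g' : z ⟶ y) (g : y ⟶ x)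
    (h' : B (cokernel (yon.map g'))) (h : B (cokernel (yon.map g))) :
    B (cokernel (yon.map (g' ≫ g))) := by
  let π := cokernel.π (yon.map (g' ≫ g))
  let α : cokernel (yon.map g') ⟶ cokernel (yon.map (g' ≫ g)) :=
    cokernel.desc _ (yon.map g ≫ π) (by
      rw [← Category.assoc, ← yon.map_comp, cokernel.condition])
  let β : cokernel (yon.map (g' ≫ g)) ⟶ cokernel (yon.map g) :=
    cokernel.desc _ (cokernel.π (yon.map g)) (by
      rw [yon.map_comp, Category.assoc, cokernel.condition, comp_zero])
  have hα : cokernel.π (yon.map g') ≫ α = yon.map g ≫ π := cokernel.π_desc _ _ _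
  have hβ : π ≫ β = cokernel.π (yon.map g) := cokernel.π_desc _ _ _
  have hαβ : α ≫ β = 0 := by
    rw [← cancel_epi (cokernel.π (yon.map g')), reassoc_of% hα, hβ, cokernel.condition,
      comp_zero]
  have hS : (ShortComplex.mk α β hαβ).Exact := exact_of_el fun c n hn => by
    obtain ⟨k, rfl⟩ := surjective_of_epi π c n
    obtain ⟨l, rfl⟩ := el_of_exact (ShortComplex.exact_cokernel (yon.map g)) c k (by
      change app (cokernel.π (yon.map g)) c k = 0
      rw [← hβ]
      exact hn)
    refine ⟨app (cokernel.π (yon.map g')) c l, ?_⟩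
    change app (cokernel.π (yon.map g') ≫ α) c l = app (yon.map g ≫ π) c l
    rw [hα]
  exact hB.prop_of_exact hS h' (finPres_cokernel_yon _) h

lemma isTorsion_zero {M : ModCat K} {x : K} : IsTorsion B (0 : El M x) := by
  refine ⟨x, 𝟙 x, map_zero _, ?_⟩
  obtain ⟨Z, hZ, hZ'⟩ := hB.containsZero.exists_zero
  exact hB.prop_of_iso (hZ.iso (isZero_cokernel_of_epi _)) hZ'

/-- The elements all of whose restrictions are `B`-torsion form a subgroup. -/
def torsionSubgroup (M : ModCat K) (x : K) : AddSubgroup (El M x) where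
  carrier := {m | ∀ (y : K) (h : y ⟶ x), IsTorsion B (res M h m)}
  zero_mem' y h := by
    rw [map_zero]
    exact hB.isTorsion_zero
  add_mem' {m n} hm hn y h := by
    obtain ⟨z, g, hg, hgB⟩ := hm y h
    obtain ⟨w, k, hk, hkB⟩ := hn z (g ≫ h)
    refine ⟨w, k ≫ g, ?_, hB.prop_cokernel_comp k g hkB hgB⟩
    rw [map_add, map_add, res_comp, hg, map_zero, zero_add, res_comp, ← res_comp M g h, hk]
  neg_mem' {m} hm y h := by
    obtain ⟨z, g, hg, hgB⟩ := hm y h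
    exact ⟨z, g, by rw [map_neg, map_neg, hg, neg_zero], hgB⟩

/-- The kernel of `m : x̂ ⟶ M` is finitely generated, and the quotient of `x̂` by it embeds in `M`. -/
lemma isTorsion_of_prop {M : ModCat K} (hM : B M) {x : K} (m : El M x) : IsTorsion B m := by
  have hker := finPres_kernel (ofEl m) (finPres_hat x) (hB.le_finPres _ hM)
  obtain ⟨y, _, n, _, hn⟩ := exists_isPresentation hker
  let g : y ⟶ x := hatHom (app (kernel.ι (ofEl m)) y n)
  have hg : res M g m = 0 := by
    rw [← app_ofEl, ← app_comp, kernel.condition, app_zero]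
  let φ : cokernel (yon.map g) ⟶ M := cokernel.desc _ (ofEl m)
    (hatHom_ext (by rw [toEl_yon_comp, toEl_ofEl, hg]; rfl))
  have hφ : cokernel.π (yon.map g) ≫ φ = ofEl m := cokernel.π_desc _ _ _
  have : Mono φ := mono_of_injective _ fun c => by
    rw [injective_iff_map_eq_zero]
    intro a ha
    obtain ⟨k, rfl⟩ := surjective_of_epi (cokernel.π (yon.map g)) c a
    rw [← app_comp, hφ] at ha
    obtain ⟨l, hl⟩ := el_of_exact (ShortComplex.exact_kernel (ofEl m)) c k ha
    obtain ⟨r, rfl⟩ := hn.exists_res c l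
    have : k = app (yon.map g) c (hatEl r) := by
      rw [app_yon, hatHom_hatEl, ← res_hatEl, hatEl_hatHom]
      exact hl.symm.trans (app_res (kernel.ι (ofEl m)) r n)
    rw [this, ← app_comp, cokernel.condition, app_zero]
  exact ⟨y, g, hg, hB.prop_of_mono φ hM (finPres_cokernel_yon g)⟩

/-- The modules all of whose elements are `B`-torsion form a Serre subcategory. -/
lemma isSerreClass_torsion :
    ObjectProperty.IsSerreClass (fun M : ModCat K => ∀ (x : K) (m : El M x), IsTorsion B m) where
  exists_zero := by
    obtain ⟨Z, hZ, hZ'⟩ := hB.containsZero.exists_zero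
    exact ⟨Z, hZ, fun x m => hB.isTorsion_of_prop hZ' m⟩
  prop_of_mono f _ hY x m := by
    obtain ⟨y, g, hg, hgB⟩ := hY x (app f x m)
    exact ⟨y, g, injective_of_mono f _ (by rw [app_res, hg, map_zero]), hgB⟩
  prop_of_epi f _ hX x m := by
    obtain ⟨m, rfl⟩ := surjective_of_epi f x m
    obtain ⟨y, g, hg, hgB⟩ := hX x m
    exact ⟨y, g, by rw [← app_res, hg, map_zero], hgB⟩
  prop_X₂_of_shortExact {S} hS h₁ h₃ x m := by
    obtain ⟨y, g, hg, hgB⟩ := h₃ x (app S.g x m)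
    obtain ⟨n, hn⟩ := el_of_exact hS.exact y (res _ g m) (by rw [app_res, hg])
    obtain ⟨z, k, hk, hkB⟩ := h₁ y n
    exact ⟨z, k ≫ g, by rw [res_comp, ← hn, ← app_res, hk, map_zero],
      hB.prop_cokernel_comp k g hkB hgB⟩

/-- Coproducts of torsion modules are torsion: the elements with torsion restrictions form a
subgroup that contains the image of every summand. -/
lemma isClosedUnderCoproducts_torsion (J : Type v) :
    ObjectProperty.IsClosedUnderColimitsOfShape
      (fun M : ModCat K => ∀ (x : K) (m : El M x), IsTorsion B m) (Discrete J) where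
  colimitsOfShape_le := by
    rintro M ⟨p⟩ x m
    have hx := isColimitOfPreserves (evalAt x) p.isColimit
    let q : (evalAt x).obj M ⟶ AddCommGrpCat.of (El M x ⧸ hB.torsionSubgroup M x) :=
      AddCommGrpCat.ofHom (QuotientAddGroup.mk' _)
    have hq : q = 0 := hx.hom_ext fun j => by
      ext n
      change QuotientAddGroup.mk' (hB.torsionSubgroup M x) (app (p.ι.app j) x n) = 0
      refine (QuotientAddGroup.eq_zero_iff _).2 fun y h => ?_
      obtain ⟨z, g, hg, hgB⟩ := p.prop_diag_obj j y (res _ h n)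
      exact ⟨z, g, by rw [← app_res, ← app_res, hg, map_zero], hgB⟩
    have hm : q m = 0 := by rw [hq]; rfl
    have := (QuotientAddGroup.eq_zero_iff _).1 hm x (𝟙 x)
    rwa [res_id] at this

lemma isTorsion_of_localizingClosure {M : ModCat K} (hM : localizingClosure B M) {x : K}
    (m : El M x) : IsTorsion B m :=
  hM _ hB.isSerreClass_torsion hB.isClosedUnderCoproducts_torsion
    (fun _ hN _ n => hB.isTorsion_of_prop hN n) x m

/-- A morphism out of `x̂` that vanishes in the Gabriel quotient is a `B`-torsion element. -/
lemma isTorsion_of_gabrielQuotient_map_eq_zero {x : K} {F : ModCat K} {f : hat x ⟶ F}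
    (hf : (gabrielQuotient B).map f = 0) : IsTorsion B (toEl f) := by
  have h := (ObjectProperty.SerreClassLocalization.map_eq_zero_iff _ (localizingClosure B) f).1 hf
  obtain ⟨y, g, hg, hgB⟩ := hB.isTorsion_of_localizingClosure h
    (toEl (Abelian.factorThruImage f))
  refine ⟨y, g, ?_, hgB⟩
  rw [← Abelian.image.fac f, toEl_comp, ← app_res, hg, map_zero]

end IsSerreTensorIdeal

end Torsion

/-! ### Tensor powers of a morphism -/

section TensorPowers

variable {K : Type u} [Category.{v} K] [MonoidalCategory K] [EssentiallySmall.{v} K]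
  [Preadditive K] [HasBinaryBiproducts K] [MonoidalPreadditive K]

lemma Similar.mono {C : Type*} [Category* C] {X Y X' Y' : C} {f : X ⟶ Y} {g : X' ⟶ Y'}
    (h : Similar f g) [Mono g] : Mono f := by
  obtain ⟨e, e', h⟩ := h
  have : f = (e.hom ≫ g) ≫ e'.inv := by rw [← h, Category.assoc, e'.hom_inv_id, Category.comp_id]
  rw [this]
  infer_instance

lemma similar_tensorPowMap_add {M N : ModCat K} (f : M ⟶ N) (n m : ℕ) :
    Similar (tensorPowMap f (n + 1 + (m + 1)))
      (tensorMap (tensorPowMap f (n + 1)) (tensorPowMap f (m + 1))) := by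
  induction m with
  | zero => exact Similar.refl _
  | succ m ih => exact (ih.tensor (Similar.refl f)).trans (similar_assoc _ _ _)

variable {M N : ModCat K} {f : M ⟶ N} {n : ℕ}

/-- Tensoring with a tensor power of a flat module preserves monomorphisms. -/
lemma tensorPow_mono (hN : IsTensorFlat N) (n : ℕ) {P Q : ModCat K} (φ : P ⟶ Q) [Mono φ] :
    Mono (tensorMap (𝟙 (tensorPow N (n + 1))) φ) := by
  have h {P Q : ModCat K} (φ : P ⟶ Q) [Mono φ] : Mono (tensorMap (𝟙 N) φ) := by
    have := hN.1
    exact inferInstanceAs (Mono ((tensorFunctor N).map φ))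
  induction n generalizing P Q with
  | zero => exact h φ
  | succ n ih =>
    have := h φ
    have := ih (tensorMap (𝟙 N) φ)
    have hs := similar_assoc (𝟙 (tensorPow N (n + 1))) (𝟙 N) φ
    rw [tensorMap_id] at hs
    exact hs.mono

lemma tensorMap_comp_whisker {M N P Q : ModCat K} (f : M ⟶ N) (g : P ⟶ Q) :
    tensorMap f (𝟙 P) ≫ tensorMap (𝟙 N) g = tensorMap f g := by
  rw [← tensorMap_comp, Category.id_comp, Category.comp_id]

lemma tensorMap_whisker_comp {M N P Q : ModCat K} (f : M ⟶ N) (g : P ⟶ Q) :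
    tensorMap (𝟙 M) g ≫ tensorMap f (𝟙 Q) = tensorMap f g := by
  rw [← tensorMap_comp, Category.id_comp, Category.comp_id]

lemma tensorMap_id_eq_zero_of_iso {P Q : ModCat K} (e : P ≅ Q) (h : tensorMap f (𝟙 P) = 0) :
    tensorMap f (𝟙 Q) = 0 :=
  ((Similar.refl f).tensor (Similar.of_iso e)).eq_zero h

lemma tensorMap_id_eq_zero_of_isZero {P : ModCat K} (h : IsZero P) : tensorMap f (𝟙 P) = 0 := by
  rw [h.eq_of_src (𝟙 P) 0, tensorMap_zero]

lemma tensorMap_id_eq_zero_of_epi {P Q : ModCat K} (φ : P ⟶ Q) [Epi φ]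
    (h : tensorMap f (𝟙 P) = 0) : tensorMap f (𝟙 Q) = 0 := by
  have := tensorMap_epi (𝟙 M) φ
  rw [← cancel_epi (tensorMap (𝟙 M) φ), tensorMap_whisker_comp, ← tensorMap_comp_whisker, h,
    zero_comp, comp_zero]

lemma tensorPowMap_eq_zero_of_mono (hN : IsTensorFlat N) {P Q : ModCat K} (φ : P ⟶ Q) [Mono φ]
    (h : tensorMap (tensorPowMap f (n + 1)) (𝟙 Q) = 0) :
    tensorMap (tensorPowMap f (n + 1)) (𝟙 P) = 0 := by
  have := tensorPow_mono hN n φ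
  rw [← cancel_mono (tensorMap (𝟙 _) φ), tensorMap_comp_whisker, ← tensorMap_whisker_comp, h,
    comp_zero, zero_comp]

variable [SymmetricCategory K]

lemma tensorMap_id_tensorObj_eq_zero (P : ModCat K) {Q : ModCat K} (h : tensorMap f (𝟙 Q) = 0) :
    tensorMap f (𝟙 (tensorObj P Q)) = 0 := by
  rw [← tensorMap_id]
  refine (similar_left_comm (𝟙 P) f (𝟙 Q)).eq_zero ?_
  rw [h, tensorMap_zero]

/-- If `f^{⊗n}` vanishes on the first term of a short exact sequence and `f^{⊗m}` vanishes on the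
third one, then `f^{⊗(n+m)}` vanishes on the middle term. -/
lemma tensorPowMap_eq_zero_of_shortExact (hN : IsTensorFlat N) {S : ShortComplex (ModCat K)}
    (hS : S.ShortExact) {m : ℕ} (h₁ : tensorMap (tensorPowMap f (n + 1)) (𝟙 S.X₁) = 0)
    (h₃ : tensorMap (tensorPowMap f (m + 1)) (𝟙 S.X₃) = 0) :
    tensorMap (tensorPowMap f (n + 1 + (m + 1))) (𝟙 S.X₂) = 0 := by
  have := hS.mono_f
  have := hS.epi_g
  have : Mono (tensorComplex (tensorPow N (m + 1)) S).f := tensorPow_mono hN m S.f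
  have hex := tensorComplex_exact (tensorPow N (m + 1)) hS.exact
  have h0 : tensorMap (tensorPowMap f (m + 1)) (𝟙 S.X₂) ≫
      (tensorComplex (tensorPow N (m + 1)) S).g = 0 := by
    rw [tensorMap_comp_whisker, ← tensorMap_whisker_comp, h₃, comp_zero]
  -- `f^{⊗m} ⊗ X₂` factors through `N^{⊗m} ⊗ X₁`, on which `f^{⊗n}` vanishes.
  let l : tensorObj (tensorPow M (m + 1)) S.X₂ ⟶ tensorObj (tensorPow N (m + 1)) S.X₁ :=
    hex.lift _ h0
  have hl : l ≫ tensorMap (𝟙 _) S.f = tensorMap (tensorPowMap f (m + 1)) (𝟙 S.X₂) :=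
    hex.lift_f _ h0
  refine (((similar_tensorPowMap_add f n m).tensor (Similar.refl (𝟙 S.X₂))).trans
    (similar_assoc _ _ _)).symm.eq_zero ?_
  have hfl : tensorMap (tensorPowMap f (n + 1)) (l ≫ tensorMap (𝟙 _) S.f) =
      tensorMap (𝟙 _) l ≫ tensorMap (tensorPowMap f (n + 1)) (𝟙 _) ≫
        tensorMap (𝟙 _) (tensorMap (𝟙 _) S.f) := by
    rw [tensorMap_comp_whisker, ← tensorMap_comp, Category.id_comp]
  rw [← hl, hfl, tensorMap_id_tensorObj_eq_zero _ h₁, zero_comp, comp_zero]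

end TensorPowers

/-! ### The ideal of modules on which a morphism is nilpotent -/

section NilpotenceIdeal

variable {K : Type u} [Category.{v} K] [EssentiallySmall.{v} K]
  [Preadditive K] [HasZeroObject K] [HasShift K ℤ]
  [∀ n : ℤ, (shiftFunctor K n).Additive] [Pretriangulated K]
  [MonoidalCategory K] [SymmetricCategory K] [MonoidalPreadditive K]

/-- Any two members of `S` have a common multiple in `S`. -/
def HasCommonMultiples (S : Set K) : Prop :=
  ∀ s ∈ S, ∀ t ∈ S, ∃ r ∈ S, ∃ a b : K, Nonempty (r ≅ a ⊗ s) ∧ Nonempty (r ≅ b ⊗ t)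

/-- The finitely presented modules `M` such that `f^{⊗n} ⊗ (ŝ ⊗ M) = 0` for some `n ≥ 1` and
some `s ∈ S`. The exponent is written as `n + 1`. -/
def nilIdeal {M N : ModCat K} (f : M ⟶ N) (S : Set K) : ObjectProperty (ModCat K) := fun P =>
  finPres K P ∧ ∃ (n : ℕ), ∃ s ∈ S,
    tensorMap (tensorPowMap f (n + 1)) (𝟙 (tensorObj (hat s) P)) = 0

lemma tensorMap_id_hat_eq_zero_of_iso {M N : ModCat K} {f : M ⟶ N} {r a s : K} (e : r ≅ a ⊗ s)
    {P : ModCat K} (h : tensorMap f (𝟙 (tensorObj (hat s) P)) = 0) :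
    tensorMap f (𝟙 (tensorObj (hat r) P)) = 0 := by
  refine tensorMap_id_eq_zero_of_iso ?_ (tensorMap_id_tensorObj_eq_zero (hat a) h)
  exact (assocIso _ _ _).symm ≪≫ tensorIso (hatTensorIso a s ≪≫ yon.mapIso e.symm) (Iso.refl P)

lemma isSerreTensorIdeal_nilIdeal [RightRigidCategory K] {M N : ModCat K} (f : M ⟶ N)
    (hN : IsTensorFlat N) {S : Set K} (hS : HasCommonMultiples S) (hne : S.Nonempty) :
    IsSerreTensorIdeal (nilIdeal f S) where
  le_finPres _ h := h.1
  containsZero := by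
    obtain ⟨s, hs⟩ := hne
    have hz : IsZero (cokernel (yon.map (𝟙 (𝟙_ K)))) := isZero_cokernel_of_epi _
    exact ⟨_, hz, finPres_cokernel_yon _, 0, s, hs,
      tensorMap_id_tensorObj_eq_zero _ (tensorMap_id_eq_zero_of_isZero hz)⟩
  mem_iff_of_shortExact T hT h₁ h₂ h₃ := by
    constructor
    · rintro ⟨-, n, s, hs, h⟩
      have hT' := hat_tensorComplex_shortExact s hT
      have := hT'.mono_f
      have := hT'.epi_g
      exact ⟨⟨h₁, n, s, hs, tensorPowMap_eq_zero_of_mono hN (tensorComplex (hat s) T).f h⟩,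
        ⟨h₃, n, s, hs, tensorMap_id_eq_zero_of_epi (tensorComplex (hat s) T).g h⟩⟩
    · rintro ⟨⟨-, n, s, hs, h⟩, ⟨-, m, t, ht, h'⟩⟩
      obtain ⟨r, hr, a, b, ⟨e⟩, ⟨e'⟩⟩ := hS s hs t ht
      exact ⟨h₂, n + 1 + m, r, hr, tensorPowMap_eq_zero_of_shortExact hN
        (hat_tensorComplex_shortExact r hT) (tensorMap_id_hat_eq_zero_of_iso e h)
        (tensorMap_id_hat_eq_zero_of_iso e' h')⟩
  tensor_mem P hP Q hQ := by
    obtain ⟨hQ, n, s, hs, h⟩ := hQ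
    exact ⟨finPres_tensorObj hP hQ, n, s, hs, tensorMap_id_eq_zero_of_iso
      (nonempty_leftComm_iso _ _ _).some (tensorMap_id_tensorObj_eq_zero P h)⟩

end NilpotenceIdeal

/-! ### Consequences of rigidity -/

section Annihilators

lemma yon_map_zero {K : Type u} [Category.{v} K] [Preadditive K] {x y : K} : yon.map (0 : x ⟶ y) = 0 :=
  hatHom_ext (by simp [toEl])

variable {K : Type u} [Category.{v} K] [EssentiallySmall.{v} K]
  [Preadditive K] [HasZeroObject K] [HasShift K ℤ]
  [∀ n : ℤ, (shiftFunctor K n).Additive] [Pretriangulated K]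
  [MonoidalCategory K] [MonoidalPreadditive K]

/-- The cokernel of `(a ⊗ g)^` is `â ⊗ coker ĝ`. -/
lemma IsSerreTensorIdeal.prop_cokernel_whiskerLeft {B : ObjectProperty (ModCat K)}
    (hB : IsSerreTensorIdeal B) (a : K) {x y : K} (g : y ⟶ x) (h : B (cokernel (yon.map g))) :
    B (cokernel (yon.map (a ◁ g))) := by
  obtain ⟨e, e', he⟩ := yon.map_id a ▸ similar_tensorMap_yon (𝟙 a) g
  rw [id_tensorHom] at he
  let S := ShortComplex.mk _ _ (cokernel.condition (yon.map g))
  have : Epi S.g := inferInstanceAs (Epi (cokernel.π _))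
  have : Epi (tensorComplex (hat a) S).g := tensorMap_epi _ _
  have hS := tensorComplex_exact (hat a) (S := S) (ShortComplex.exact_cokernel _)
  refine hB.prop_of_iso ?_ (hB.tensor_mem _ (finPres_hat a) h)
  exact hS.gIsCokernel.coconePointUniqueUpToIso (colimit.isColimit _) ≪≫
    cokernel.mapIso _ _ e e' he

/-- Let `g : y ⟶ x` kill `f : x̂ ⟶ F`, and let `N ⊆ 1̂` be the kernel of
`1̂ ⟶ (ᘁx ⊗ x)^ ⟶ ᘁx^ ⊗ coker ĝ`. Then `f ⊗ N` composed with `F ⊗ N ⊆ F ⊗ 1̂` vanishes because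
`x ⊗ N ⟶ x` factors through `g` up to the duality adjunction. Flatness of `F` gives
`f ⊗ N = 0`, and `1̂ / N` embeds in `ᘁx^ ⊗ coker ĝ`. -/
lemma exists_tensorMap_eq_zero {x y : K} [HasLeftDual x] {F : ModCat K} (hF : IsTensorFlat F)
    (f : hat x ⟶ F) (g : y ⟶ x) (hg : res F g (toEl f) = 0) :
    ∃ N : ModCat K, finPres K N ∧ tensorMap f (𝟙 N) = 0 ∧ ∀ B : ObjectProperty (ModCat K),
      IsSerreTensorIdeal B → B (cokernel (yon.map g)) → B N → B (hat (𝟙_ K)) := by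
  obtain ⟨w, u, q, huq, hw⟩ := exists_weakPullback (η_ (ᘁx) x) ((ᘁx) ◁ g)
  refine ⟨Abelian.image (yon.map u), finPres_image _ (finPres_hat _) (finPres_hat _), ?_,
    fun B hB hgB hN => ?_⟩
  -- The adjunct of `x ⊗ w ⟶ x` is `w ⟶ 1 ⟶ ᘁx ⊗ x`, which factors through `ᘁx ⊗ g`.
  · have hxu : x ◁ u ≫ (ρ_ x).hom = (tensorLeftHomEquiv w (ᘁx) x y).symm q ≫ g := by
      apply (tensorLeftHomEquiv w (ᘁx) x x).injective
      rw [tensorLeftHomEquiv_naturality _ g, Equiv.apply_symm_apply, ← huq]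
      simp only [tensorLeftHomEquiv, Equiv.coe_fn_mk, MonoidalCategory.whiskerLeft_comp]
      rw [← associator_naturality_right_assoc, ← whisker_exchange_assoc]
      simp [unitors_inv_equal]
    have hxu' : x ◁ u = (tensorLeftHomEquiv w (ᘁx) x y).symm q ≫ (ρ_ y).inv ≫ g ▷ 𝟙_ K := by
      rw [← cancel_mono (ρ_ x).hom, hxu]
      simp
    have hfu : tensorMap f (yon.map u) = 0 := tensorHom_ext fun c d a b => by
      have hb : app (yon.map u) d b = res _ (hatHom b) (res _ u (hatEl (𝟙 (𝟙_ K)))) := by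
        simp
      rw [app_tensorMap, app_eq_res_toEl, hb, ← res_tmul, ← res_whiskerLeft_tmul, hxu', res_comp,
        res_comp, res_whiskerRight_tmul, hg, zero_tmul, map_zero, map_zero, map_zero, app_zero]
    have := tensorMap_epi (𝟙 (hat x)) (Abelian.factorThruImage (yon.map u))
    have : Mono (tensorMap (𝟙 F) (Abelian.image.ι (yon.map u))) := tensorPow_mono hF 0 _
    rw [← cancel_epi (tensorMap (𝟙 (hat x)) (Abelian.factorThruImage (yon.map u))),
      tensorMap_whisker_comp, ← cancel_mono (tensorMap (𝟙 F) (Abelian.image.ι (yon.map u))),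
      ← tensorMap_comp, Abelian.image.fac, Category.comp_id, hfu, comp_zero, zero_comp]
  · have hz : Abelian.image.ι (yon.map u) ≫
        yon.map (η_ (ᘁx : K) x) ≫ cokernel.π (yon.map ((ᘁx : K) ◁ g)) = 0 := by
      rw [← cancel_epi (Abelian.factorThruImage (yon.map u)), ← Category.assoc, Abelian.image.fac,
        ← yon.map_comp_assoc, huq, yon.map_comp_assoc, cokernel.condition, comp_zero, comp_zero]
    have hS : (ShortComplex.mk _ _ hz).Exact := exact_of_el fun c m hm => by
      obtain ⟨l, hl⟩ := el_of_exact (ShortComplex.exact_cokernel (yon.map ((ᘁx : K) ◁ g))) c _ hm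
      obtain ⟨t, ht, -⟩ := hw (hatHom m) (hatHom l) (hatEl_injective
        (((app_yon _ _).symm.trans hl.symm).trans (app_yon _ _)))
      refine ⟨app (Abelian.factorThruImage (yon.map u)) c (hatEl t), ?_⟩
      change app (Abelian.factorThruImage (yon.map u) ≫ Abelian.image.ι (yon.map u)) c _ = m
      rw [Abelian.image.fac, app_yon, hatHom_hatEl, ht, hatEl_hatHom]
    exact hB.prop_of_exact hS hN (finPres_hat _) (hB.prop_cokernel_whiskerLeft _ g hgB)

variable [SymmetricCategory K]

lemma isZero_of_epi_mono {C : Type*} [Category* C] [HasZeroMorphisms C] {X Y Z : C} (p : X ⟶ Y)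
    (i : Y ⟶ Z) [Epi p] [Mono i] (h : p ≫ i = 0) : IsZero Y := by
  rw [IsZero.iff_id_eq_zero, ← cancel_epi p, ← cancel_mono i]
  simpa using h

/-- Let `N ⊆ 1̂` be the kernel of the coevaluation of `s`. By the triangle identity `ŝ ⊗ N = 0`,
whereas a Serre `⊗`-ideal that contains `N` and `ŝ` contains the unit. -/
lemma exists_tensor_isZero (s : K) [HasRightDual s] : ∃ N : ModCat K, finPres K N ∧
    IsZero (tensorObj (hat s) N) ∧ ∀ B : ObjectProperty (ModCat K), IsSerreTensorIdeal B →
      B (hat s) → B N → B (hat (𝟙_ K)) := by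
  obtain ⟨w, u, hu, hw⟩ := exists_weakKernel (η_ s sᘁ)
  refine ⟨Abelian.image (yon.map u), finPres_image _ (finPres_hat _) (finPres_hat _), ?_,
    fun B hB hs hN => ?_⟩
  · have := tensorMap_epi (𝟙 (hat s)) (Abelian.factorThruImage (yon.map u))
    have := hat_tensorMap_mono s (Abelian.image.ι (yon.map u))
    refine isZero_of_epi_mono (tensorMap (𝟙 (hat s)) (Abelian.factorThruImage (yon.map u)))
      (tensorMap (𝟙 (hat s)) (Abelian.image.ι (yon.map u))) ?_
    rw [← tensorMap_comp, Category.comp_id, Abelian.image.fac]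
    have hus : u ▷ s = 0 := by
      have h : u ▷ s ≫ (η_ s sᘁ ▷ s ≫ (α_ s sᘁ s).hom ≫ s ◁ ε_ s sᘁ) = 0 := by
        rw [← comp_whiskerRight_assoc, hu, MonoidalPreadditive.zero_whiskerRight, zero_comp]
      rw [ExactPairing.evaluation_coevaluation] at h
      rw [← cancel_mono ((λ_ s).hom ≫ (ρ_ s).inv), h, zero_comp]
    have hsim := (similar_braid (𝟙 (hat s)) (yon.map u)).trans
      (yon.map_id s ▸ similar_tensorMap_yon u (𝟙 s))
    rw [tensorHom_id, hus] at hsim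
    exact hsim.symm.eq_zero yon_map_zero
  · have hz : Abelian.image.ι (yon.map u) ≫ yon.map (η_ s sᘁ) = 0 := by
      rw [← cancel_epi (Abelian.factorThruImage (yon.map u)), ← Category.assoc, Abelian.image.fac,
        ← yon.map_comp, hu, yon_map_zero, comp_zero]
    have hS : (ShortComplex.mk _ _ hz).Exact := exact_of_el fun c m hm => by
      obtain ⟨t, ht⟩ := hw (hatHom m) (hatEl_injective (by rw [← app_yon]; exact hm))
      refine ⟨app (Abelian.factorThruImage (yon.map u)) c (hatEl t), ?_⟩
      change app (Abelian.factorThruImage (yon.map u) ≫ Abelian.image.ι (yon.map u)) c _ = m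
      rw [Abelian.image.fac, app_yon, hatHom_hatEl, ht, hatEl_hatHom]
    exact hB.prop_of_exact hS hN (finPres_hat _)
      (hB.prop_of_iso (yon.mapIso (β_ _ _)) (hB.prop_hat_tensor sᘁ hs))

end Annihilators

/-! ### Nilpotence -/

section Nilpotence

variable {K : Type u} [Category.{v} K] [EssentiallySmall.{v} K]
  [Preadditive K] [HasZeroObject K] [HasShift K ℤ]
  [∀ n : ℤ, (shiftFunctor K n).Additive] [Pretriangulated K]
  [MonoidalCategory K] [SymmetricCategory K] [MonoidalPreadditive K] [RigidCategory K]

/-- If no `f^{⊗n} ⊗ ŝ` with `s ∈ S` vanishes, there is a homological prime which contains no `ŝ`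
with `s ∈ S`, contains all finitely presented modules on which a power of `f` vanishes, and for
which `f` is not a torsion element. -/
lemma exists_isHomologicalPrime_of_not_nilpotent {x : K} {F : ModCat K} (hF : IsTensorFlat F)
    (f : hat x ⟶ F) {S : Set K} (hS : HasCommonMultiples S) (hne : S.Nonempty)
    (h : ∀ (n : ℕ), ∀ s ∈ S, tensorMap (tensorPowMap f (n + 1)) (𝟙 (hat s)) ≠ 0) :
    ∃ B : ObjectProperty (ModCat K), IsHomologicalPrime B ∧ (∀ s ∈ S, ¬ B (hat s)) ∧
      (∀ (n : ℕ) (M : ModCat K), finPres K M →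
        tensorMap (tensorPowMap f (n + 1)) (𝟙 M) = 0 → B M) ∧
      ¬ IsTorsion B (toEl f) := by
  obtain ⟨s₀, hs₀⟩ := hne
  have hJ := isSerreTensorIdeal_nilIdeal f hF hS ⟨s₀, hs₀⟩
  obtain ⟨B, hJB, hB⟩ := exists_isHomologicalPrime hJ (by
    rintro ⟨-, n, s, hs, hn⟩
    exact h n s hs (tensorMap_id_eq_zero_of_iso
      (hatTensorIso _ _ ≪≫ yon.mapIso (ρ_ s)) hn))
  have hunit := hB.prop.1.ne_finPres_iff.1 hB.prop.2
  refine ⟨B, hB, fun s hs hsB => ?_, fun n M hM hn => ?_, ?_⟩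
  · obtain ⟨N, hN, hz, hNB⟩ := exists_tensor_isZero s
    exact hunit (hNB B hB.prop.1 hsB
      (hJB N ⟨hN, 0, s, hs, tensorMap_id_eq_zero_of_isZero hz⟩))
  · exact hJB M ⟨hM, n, s₀, hs₀, tensorMap_id_tensorObj_eq_zero _ hn⟩
  · rintro ⟨y, g, hg, hgB⟩
    obtain ⟨N, hN, hz, hNB⟩ := exists_tensorMap_eq_zero hF f g hg
    exact hunit (hNB B hB.prop.1 hgB
      (hJB N ⟨hN, 0, s₀, hs₀, tensorMap_id_tensorObj_eq_zero _ hz⟩))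

end Nilpotence

/-! ### Closed subsets of the spectrum -/

section Spectrum

variable {K : Type u} [Category.{v} K] [Preadditive K] [HasZeroObject K] [HasShift K ℤ]
  [∀ n : ℤ, (shiftFunctor K n).Additive] [Pretriangulated K] [MonoidalCategory K]

lemma TriangularPrime.carrier_of_retract (P : TriangularPrime K) {x y : K} (r : Retract x y)
    (h : P.carrier y) : P.carrier x :=
  have := P.isStableUnderRetracts
  P.carrier.prop_of_retract r h

lemma TriangularPrime.not_carrier_unit (P : TriangularPrime K) : ¬ P.carrier (𝟙_ K) := fun h => by
  obtain ⟨x, hx⟩ := P.exists_notMem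
  exact hx (P.carrier_of_retract (Retract.ofIso (ρ_ x).symm) (P.tensor_mem x h))

lemma TriangularPrime.carrier_biprod (P : TriangularPrime K) {x y : K} (hx : P.carrier x)
    (hy : P.carrier y) : P.carrier (x ⊞ y) := by
  have := P.isTriangulated
  obtain ⟨z, hz, ⟨e⟩⟩ := P.carrier.ext_of_isTriangulatedClosed₂' _
    (Pretriangulated.binaryBiproductTriangle_distinguished x y) hx hy
  exact P.carrier_of_retract (Retract.ofIso e) hz

/-- The complements of supports form a basis of open neighbourhoods. -/
lemma exists_carrier_of_isOpen {U : Set (TriangularPrime K)} (hU : IsOpen U)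
    {P : TriangularPrime K} (hP : P ∈ U) : ∃ s : K, P.carrier s ∧ (supp s)ᶜ ⊆ U := by
  induction hU with
  | basic U hU =>
    obtain ⟨s, rfl⟩ := hU
    exact ⟨s, not_not.1 hP, subset_rfl⟩
  | univ =>
    have := P.isTriangulated
    obtain ⟨Z, -, hZ⟩ := P.carrier.exists_prop_of_containsZero
    exact ⟨Z, hZ, Set.subset_univ _⟩
  | inter U V _ _ hU hV =>
    obtain ⟨s, hs, hsU⟩ := hU hP.1
    obtain ⟨t, ht, htV⟩ := hV hP.2
    refine ⟨s ⊞ t, P.carrier_biprod hs ht, fun Q hQ => ?_⟩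
    have hQ' : Q.carrier (s ⊞ t) := not_not.1 hQ
    exact ⟨hsU (not_not.2 (Q.carrier_of_retract ⟨biprod.inl, biprod.fst, by simp⟩ hQ')),
      htV (not_not.2 (Q.carrier_of_retract ⟨biprod.inr, biprod.snd, by simp⟩ hQ'))⟩
  | sUnion T _ h =>
    obtain ⟨U, hUT, hPU⟩ := hP
    obtain ⟨s, hs, hsU⟩ := h U hUT hPU
    exact ⟨s, hs, hsU.trans (Set.subset_sUnion_of_mem hUT)⟩

/-- A closed subset contains every prime that avoids all objects whose support contains it. -/
lemma mem_of_isClosed {W : Set (TriangularPrime K)} (hW : IsClosed W) {P : TriangularPrime K}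
    (h : ∀ s : K, W ⊆ supp s → ¬ P.carrier s) : P ∈ W := by
  by_contra hP
  obtain ⟨s, hs, hsW⟩ := exists_carrier_of_isOpen hW.isOpen_compl hP
  exact h s (Set.compl_subset_compl.1 hsW) hs

end Spectrum

end TTNilpotence

end

open TTNilpotence in
theorem theorem4p1 {K : Type u} [Category.{v} K] [EssentiallySmall.{v} K]
    [Preadditive K] [HasZeroObject K] [HasShift K ℤ]
    [∀ n : ℤ, (shiftFunctor K n).Additive] [Pretriangulated K] [IsTriangulated K]
    [MonoidalCategory K] [SymmetricCategory K] [TensorTriangulated K] [RigidCategory K]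
    (W : Set (TriangularPrime K)) (hW : IsClosed W)
    (x : K) (F : ModCat K) (hF : IsTensorFlat F) (f : hat x ⟶ F)
    (hf : ∀ B : ObjectProperty (ModCat K), IsHomologicalPrime B → LivesOver B W →
      (gabrielQuotient B).map f = 0) :
    (∃ (s : K) (n : ℕ), W ⊆ supp s ∧ 1 ≤ n ∧ tensorMap (tensorPowMap f n) (𝟙 (hat s)) = 0) ∧
    (∀ s : K, W ⊆ supp s → (∃ n : ℕ, 1 ≤ n ∧ tensorMap (tensorPowMap f n) (𝟙 (hat s)) = 0) →
      ∀ z : K, supp z ⊆ supp s →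
        ∃ m : ℕ, 1 ≤ m ∧ tensorMap (tensorPowMap f m) (𝟙 (hat z)) = 0) := by
  constructor
  · by_contra! hn
    have hS : HasCommonMultiples {s : K | W ⊆ supp s} := fun s hs t ht =>
      ⟨s ⊗ t, fun P hP h => (P.mem_or_mem h).elim (hs hP) (ht hP), t, s, ⟨β_ s t⟩,
        ⟨Iso.refl _⟩⟩
    obtain ⟨B, hB, hSB, -, htors⟩ := exists_isHomologicalPrime_of_not_nilpotent hF f hS
      ⟨𝟙_ K, fun P _ => P.not_carrier_unit⟩ fun n s hs => hn s (n + 1) hs (Nat.le_add_left 1 n)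
    have hP : hB.prime ∈ W := mem_of_isClosed hW hSB
    exact htors (hB.prop.1.isTorsion_of_gabrielQuotient_map_eq_zero
      (hf B hB ⟨hB.prime, hP, fun _ => Iff.rfl⟩))
  · rintro s - ⟨n, hn, hs⟩ z hz
    by_contra! h
    have hS : HasCommonMultiples {z} := by
      rintro _ rfl _ rfl
      exact ⟨_, rfl, 𝟙_ K, 𝟙_ K, ⟨(λ_ _).symm⟩, ⟨(λ_ _).symm⟩⟩
    obtain ⟨B, hB, hzB, hJ, -⟩ := exists_isHomologicalPrime_of_not_nilpotent hF f hS
      ⟨z, rfl⟩ fun n t ht => by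
        obtain rfl := ht
        exact h (n + 1) (Nat.le_add_left 1 n)
    obtain ⟨n, rfl⟩ := Nat.exists_eq_add_of_le' hn
    have hP : hB.prime ∈ supp s := hz (hzB z rfl)
    exact hP (hJ n (hat s) (finPres_hat s) hs)
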